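/- Let $k$ be an algebraically closed field and let $C$ be a finite-dimensional associative unital $k$-algebra of global dimension $2$. All modules are right modules and $D=\operatorname{Hom}_k(-,k)$. Let $E=\operatorname{Ext}^2_C(DC,C)$ with its natural $C$-$C$-bimodule structure, and let $B=C\ltimes E$ be the trivial extension, that is, the algebra $C\oplus E$ with product $(c,e)(c',e')=(cc',ce'+ec')$. Every $C$-module $X$ is regarded as a $B$-module through $x\cdot(c,e)=xc$. For a finite-dimensional algebra $\Lambda$ let $\tau_\Lambda=D\operatorname{Tr}$ denote the Auslander–Reiten translation: if $P_1\to P_0\to X\to 0$ is a minimal projective presentation of a finitely generated $\Lambda$-module $X$, then $\tau_\Lambda X=D\operatorname{coker}\bigl(\operatorname{Hom}_\Lambda(P_0,\Lambda)\to\operatorname{Hom}_\Lambda(P_1,\Lambda)\bigr)$. Then for every finitely generated $C$-module $M$, $$\tau_C M\cong\tau_B M \text{ as } B\text{-modules}\quad\Longleftrightarrow\quad \operatorname{pd}_C(\tau_C M)\le 1 \ \text{ and }\ \operatorname{id}_C M\le 1 .$$ -/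

import Mathlib

open CategoryTheory Abelian

universe u

namespace RelationExtension

noncomputable section

/-! Conventions: `k` is a field and algebras are associative and unital.  Modules over an algebra `A`
are right modules; a right `A`-module is a module over the opposite ring `Aᵐᵒᵖ`, the element
`m a` being written `MulOpposite.op a • m`. -/

/-! ### The standard duality `D = Hom_k(-, k)` -/

/-- The dual `D X = Hom_k(X, k)` of a left `A`-module `X`, as a right `A`-module. -/
def StdDual (k : Type u) (X : Type u) [Field k] [AddCommGroup X] [Module k X] : Type u :=
  X →ₗ[k] k

namespace StdDual

variable {k A X : Type u} [Field k] [Ring A] [Algebra k A] [AddCommGroup X] [Module k X]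
  [Module A X] [IsScalarTower k A X]

instance : AddCommGroup (StdDual k X) := inferInstanceAs (AddCommGroup (X →ₗ[k] k))

instance : Module k (StdDual k X) := inferInstanceAs (Module k (X →ₗ[k] k))

instance : FunLike (StdDual k X) X k := inferInstanceAs (FunLike (X →ₗ[k] k) X k)

@[ext] theorem ext {f g : StdDual k X} (h : ∀ x, f x = g x) : f = g := LinearMap.ext h

/-- The right action of `A` on `D X` is `(f a)(x) = f (a x)`. -/
instance : Module Aᵐᵒᵖ (StdDual k X) where
  smul a f := LinearMap.comp (show X →ₗ[k] k from f) (Algebra.lsmul k k X a.unop)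
  one_smul f := ext fun x => congrArg f (one_smul A x)
  mul_smul a b f := ext fun x => congrArg f (mul_smul b.unop a.unop x)
  smul_zero _ := rfl
  smul_add _ _ _ := rfl
  add_smul a b f := ext fun x =>
    (congrArg f (add_smul a.unop b.unop x)).trans (map_add (show X →ₗ[k] k from f) _ _)
  zero_smul f := ext fun x =>
    (congrArg f (zero_smul A x)).trans (map_zero (show X →ₗ[k] k from f))

theorem op_smul_apply (a : A) (f : StdDual k X) (x : X) : (MulOpposite.op a • f) x = f (a • x) :=
  rfl

instance : IsScalarTower k Aᵐᵒᵖ (StdDual k X) where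
  smul_assoc c a f := ext fun x =>
    (congrArg f (smul_assoc c a.unop x)).trans (map_smul (show X →ₗ[k] k from f) c _)

end StdDual

/-! ### Minimal projective presentations and the Auslander–Reiten translation -/

/-- A submodule `K` of `P` is superfluous if `N + K = P` implies `N = P`. -/
def IsSuperfluous {R P : Type u} [Ring R] [AddCommGroup P] [Module R P] (K : Submodule R P) : Prop :=
  ∀ N : Submodule R P, N ⊔ K = ⊤ → N = ⊤

/-- A minimal projective presentation `P₁ → P₀ → M → 0` by finitely generated modules: `P₀ → M` and
`P₁ → ker (P₀ → M)` are projective covers. -/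
structure MinProjPresentation (R M : Type u) [Ring R] [AddCommGroup M] [Module R M] where
  P₁ : Type u
  P₀ : Type u
  [addCommGroup₁ : AddCommGroup P₁]
  [addCommGroup₀ : AddCommGroup P₀]
  [module₁ : Module R P₁]
  [module₀ : Module R P₀]
  finite₁ : Module.Finite R P₁
  finite₀ : Module.Finite R P₀
  projective₁ : Module.Projective R P₁
  projective₀ : Module.Projective R P₀
  d₁ : P₁ →ₗ[R] P₀
  d₀ : P₀ →ₗ[R] M
  surjective : Function.Surjective d₀
  exact : LinearMap.range d₁ = LinearMap.ker d₀
  minimal₀ : IsSuperfluous (LinearMap.ker d₀)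
  minimal₁ : IsSuperfluous (LinearMap.ker d₁)

attribute [instance] MinProjPresentation.addCommGroup₁ MinProjPresentation.addCommGroup₀
  MinProjPresentation.module₁ MinProjPresentation.module₀

/-- Finitely generated modules over an Artinian ring have projective covers. -/
theorem exists_projectiveCover (R M : Type u) [Ring R] [IsArtinianRing R] [AddCommGroup M]
    [Module R M] [Module.Finite R M] :
    ∃ (P : Type u) (_ : AddCommGroup P) (_ : Module R P) (p : P →ₗ[R] M),
      Module.Finite R P ∧ Module.Projective R P ∧ Function.Surjective p ∧
        IsSuperfluous (LinearMap.ker p) := by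
  obtain ⟨n, f, hf⟩ := Module.Finite.exists_fin' R M
  let S : Set (Submodule R (Fin n → R)) :=
    {N | Module.Projective R N ∧ Function.Surjective (f ∘ₗ N.subtype)}
  have hS : (⊤ : Submodule R (Fin n → R)) ∈ S := by
    refine ⟨Module.Projective.of_equiv (Submodule.topEquiv (R := R) (M := Fin n → R)).symm, ?_⟩
    intro y
    obtain ⟨x, hx⟩ := hf y
    exact ⟨⟨x, trivial⟩, hx⟩
  obtain ⟨N, ⟨hN, hp⟩, hmin⟩ := wellFounded_lt.has_min S ⟨⊤, hS⟩
  refine ⟨N, inferInstance, inferInstance, f ∘ₗ N.subtype, inferInstance, hN, hp, ?_⟩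
  intro N' hN'
  set p := f ∘ₗ N.subtype with hpdef
  have hsurj : Function.Surjective (p ∘ₗ N'.subtype) := by
    rw [← LinearMap.range_eq_top, LinearMap.range_comp, Submodule.range_subtype]
    have h := congrArg (Submodule.map p) hN'
    rw [Submodule.map_sup, Submodule.map_top, LinearMap.range_eq_top.2 hp] at h
    have h0 : Submodule.map p (LinearMap.ker p) = ⊥ :=
      le_bot_iff.1 (Submodule.map_le_iff_le_comap.2 le_rfl)
    rwa [h0, sup_bot_eq] at h
  obtain ⟨g₀, hg₀⟩ := Module.projective_lifting_property (p ∘ₗ N'.subtype) p hsurj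
  let g : Module.End R N := N'.subtype ∘ₗ g₀
  have hpg : ∀ m : ℕ, ∀ x, p ((g ^ m) x) = p x := by
    intro m
    induction m with
    | zero => intro x; rfl
    | succ m ih =>
      intro x
      rw [pow_succ, Module.End.mul_apply, ih]
      exact LinearMap.congr_fun hg₀ x
  obtain ⟨m, hm, hm1⟩ :=
    ((g.eventually_isCompl_ker_pow_range_pow).and (Filter.eventually_ge_atTop 1)).exists
  have hle : LinearMap.range (g ^ m) ≤ N' := by
    rintro _ ⟨x, rfl⟩
    obtain ⟨m, rfl⟩ := Nat.exists_eq_add_of_le' hm1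
    rw [pow_succ', Module.End.mul_apply]
    exact (g₀ _).2
  let L : Submodule R (Fin n → R) := (LinearMap.range (g ^ m)).map N.subtype
  have hproj : Module.Projective R (LinearMap.range (g ^ m)) :=
    Module.Projective.of_split (LinearMap.range (g ^ m)).subtype
      (Submodule.projectionOnto _ _ hm.symm)
      (LinearMap.ext fun x => Submodule.projectionOnto_apply_left hm.symm x)
  have hL : L ∈ S := by
    refine ⟨Module.Projective.of_equiv
      (Submodule.equivMapOfInjective N.subtype N.injective_subtype (LinearMap.range (g ^ m))), ?_⟩
    intro y
    obtain ⟨x, hx⟩ := hp y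
    exact ⟨⟨_, Submodule.mem_map_of_mem (LinearMap.mem_range_self (g ^ m) x)⟩,
      (hpg m x).trans hx⟩
  have hLN : L = N := by
    by_contra hne
    exact hmin L hL (lt_of_le_of_ne (Submodule.map_subtype_le _ _) hne)
  rw [eq_top_iff]
  intro x _
  have hx : (x : Fin n → R) ∈ L := hLN.symm.le x.2
  obtain ⟨y, hy, hyx⟩ := hx
  have : y = x := N.injective_subtype hyx
  rw [← this]
  exact hle hy

theorem nonempty_minProjPresentation (R M : Type u) [Ring R] [IsArtinianRing R] [AddCommGroup M]
    [Module R M] [Module.Finite R M] : Nonempty (MinProjPresentation R M) := by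
  obtain ⟨P₀, _, _, p, hf, hp, hs, hm⟩ := exists_projectiveCover R M
  obtain ⟨P₁, _, _, q, hf', hp', hs', hm'⟩ := exists_projectiveCover R (LinearMap.ker p)
  exact ⟨{ P₁ := P₁, P₀ := P₀, finite₁ := hf', finite₀ := hf, projective₁ := hp',
           projective₀ := hp, d₁ := (LinearMap.ker p).subtype ∘ₗ q, d₀ := p, surjective := hs
           exact := by
            rw [LinearMap.range_comp, LinearMap.range_eq_top.2 hs', Submodule.map_top,
              Submodule.range_subtype]
           minimal₀ := hm
           minimal₁ := by
            rwa [LinearMap.ker_comp_of_ker_eq_bot _ (Submodule.ker_subtype _)] }⟩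

section Translate

/-- For a map `d : P → Q` of right `A`-modules, the map `Hom_A(d, A) : Hom_A(Q, A) → Hom_A(P, A)` of
left `A`-modules, where `(a f)(x) = a f(x)`. -/
def homDual {A P Q : Type u} [Ring A] [AddCommGroup P] [AddCommGroup Q] [Module Aᵐᵒᵖ P]
    [Module Aᵐᵒᵖ Q] (d : P →ₗ[Aᵐᵒᵖ] Q) : (Q →ₗ[Aᵐᵒᵖ] A) →ₗ[A] (P →ₗ[Aᵐᵒᵖ] A) where
  toFun f := f ∘ₗ d
  map_add' _ _ := rfl
  map_smul' _ _ := rfl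

/-- The transpose computed from a minimal projective presentation: the left `A`-module
`coker (Hom_A(P₀, A) → Hom_A(P₁, A))`. -/
abbrev transpose {A M : Type u} [Ring A] [AddCommGroup M] [Module Aᵐᵒᵖ M]
    (P : MinProjPresentation Aᵐᵒᵖ M) : Type u :=
  (P.P₁ →ₗ[Aᵐᵒᵖ] A) ⧸ LinearMap.range (homDual P.d₁)

variable (k A : Type u) [Field k] [Ring A] [Algebra k A]

theorem isArtinianRing_op [Module.Finite k A] : IsArtinianRing Aᵐᵒᵖ :=
  IsArtinianRing.of_finite k Aᵐᵒᵖ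

/-- The Auslander–Reiten translation `τ_A M = D Tr M` of a finitely generated right module `M` over
the finite-dimensional `k`-algebra `A`, computed from a chosen minimal projective presentation
(two such presentations are isomorphic). -/
def tau [Module.Finite k A] (M : ModuleCat.{u} Aᵐᵒᵖ) [Module.Finite Aᵐᵒᵖ M] : ModuleCat.{u} Aᵐᵒᵖ :=
  haveI := isArtinianRing_op k A
  ModuleCat.of Aᵐᵒᵖ (StdDual k (transpose (nonempty_minProjPresentation Aᵐᵒᵖ M).some))

/-- The global dimension: the supremum of the projective dimensions of the right modules. -/
def globalDimension (A : Type u) [Ring A] : WithBot ℕ∞ :=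
  ⨆ M : ModuleCat.{u} Aᵐᵒᵖ, projectiveDimension M

end Translate

/-! ### The bimodule `Ext²_C(DC, C)` and the relation extension -/

section Bimodule

variable (k C : Type u) [Field k] [Ring C] [Algebra k C]

/-- `DC` as a right `C`-module. -/
abbrev dualModule : ModuleCat.{u} Cᵐᵒᵖ := ModuleCat.of Cᵐᵒᵖ (StdDual k C)

/-- `C` as a right `C`-module. -/
abbrev regularModule : ModuleCat.{u} Cᵐᵒᵖ := ModuleCat.of Cᵐᵒᵖ C

variable {C} in
/-- Left multiplication `x ↦ c x` on `C`, an endomorphism of the right module `C`. -/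
def leftMul (c : C) : regularModule C ⟶ regularModule C :=
  ModuleCat.ofHom (Y := C)
    { toFun := fun x : C => c * x
      map_add' := mul_add c
      map_smul' := fun a x => (mul_assoc c x a.unop).symm }

variable {C} in
/-- Left multiplication by `c` on the bimodule `DC`, namely `(c f)(x) = f (x c)`, an endomorphism
of the right module `DC`. -/
def dualLeftMul (c : C) : dualModule k C ⟶ dualModule k C :=
  ModuleCat.ofHom (X := StdDual k C) (Y := StdDual k C)
    { toFun := fun f => LinearMap.comp (show C →ₗ[k] k from f) (LinearMap.mulRight k c)
      map_add' := fun _ _ => rfl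
      map_smul' := fun a f => StdDual.ext fun x => congrArg f (mul_assoc a.unop x c).symm }

theorem dualLeftMul_apply (c : C) (f : StdDual k C) (x : C) :
    (show StdDual k C from (dualLeftMul k c).hom f) x = f (x * c) := rfl

/-- The `C`-`C`-bimodule `E = Ext²_C(DC, C)`, with `Ext` taken in the category of right modules. -/
abbrev ExtBimodule : Type u := Ext.{u} (dualModule k C) (regularModule C) 2

namespace ExtBimodule

open MulOpposite (unop_one unop_mul unop_zero unop_smul)

/-- The left action of `C`, by functoriality of `Ext` in the second variable. -/
instance : SMul C (ExtBimodule k C) :=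
  ⟨fun c e => Ext.comp e (Ext.mk₀ (leftMul c)) (add_zero 2)⟩

/-- The right action of `C`, by functoriality of `Ext` in the first variable. -/
instance : SMul Cᵐᵒᵖ (ExtBimodule k C) :=
  ⟨fun c e => (Ext.mk₀ (dualLeftMul k c.unop)).comp e (zero_add 2)⟩

variable {k C}

theorem smul_def (c : C) (e : ExtBimodule k C) :
    c • e = Ext.comp e (Ext.mk₀ (leftMul c)) (add_zero 2) := rfl

theorem op_smul_def (c : Cᵐᵒᵖ) (e : ExtBimodule k C) :
    c • e = (Ext.mk₀ (dualLeftMul k c.unop)).comp e (zero_add 2) := rfl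

theorem leftMul_one : leftMul (1 : C) = 𝟙 _ :=
  ModuleCat.hom_ext (LinearMap.ext fun x : C => one_mul x)

theorem leftMul_mul (a b : C) : leftMul (a * b) = leftMul b ≫ leftMul a :=
  ModuleCat.hom_ext (LinearMap.ext fun x : C => mul_assoc a b x)

theorem leftMul_add (a b : C) : leftMul (a + b) = leftMul a + leftMul b :=
  ModuleCat.hom_ext (LinearMap.ext fun x : C => add_mul a b x)

theorem mk₀_leftMul_smul (r : k) (a : C) :
    Ext.mk₀ (leftMul (r • a)) = r • Ext.mk₀ (leftMul a) := by
  rw [← Ext.mk₀_smul]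
  congr 1
  exact ModuleCat.hom_ext (LinearMap.ext fun x : C =>
    show (r • a) * x = (a * x) * algebraMap k C r by
      rw [← Algebra.commutes, Algebra.smul_def, mul_assoc])

theorem dualLeftMul_one : dualLeftMul k (1 : C) = 𝟙 _ :=
  ModuleCat.hom_ext (LinearMap.ext fun f : StdDual k C => StdDual.ext fun x =>
    congrArg f (mul_one x))

theorem dualLeftMul_mul (a b : C) :
    dualLeftMul k (a * b) = dualLeftMul k b ≫ dualLeftMul k a :=
  ModuleCat.hom_ext (LinearMap.ext fun f : StdDual k C => StdDual.ext fun x =>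
    congrArg f (mul_assoc x a b).symm)

theorem dualLeftMul_add (a b : C) :
    dualLeftMul k (a + b) = dualLeftMul k a + dualLeftMul k b :=
  ModuleCat.hom_ext (LinearMap.ext fun f : StdDual k C => StdDual.ext fun x =>
    (congrArg f (mul_add x a b)).trans (map_add (show C →ₗ[k] k from f) _ _))

theorem mk₀_dualLeftMul_smul (r : k) (a : C) :
    Ext.mk₀ (dualLeftMul k (r • a)) = r • Ext.mk₀ (dualLeftMul k a) := by
  rw [← Ext.mk₀_smul]
  congr 1
  exact ModuleCat.hom_ext (LinearMap.ext fun f : StdDual k C => StdDual.ext fun x =>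
    congrArg f (show x * (r • a) = algebraMap k C r * x * a by
      rw [mul_smul_comm, Algebra.smul_def, mul_assoc]))

instance : Module C (ExtBimodule k C) where
  one_smul e := by rw [smul_def, leftMul_one, Ext.comp_mk₀_id]
  mul_smul a b e := by
    rw [smul_def, smul_def, smul_def, leftMul_mul, ← Ext.mk₀_comp_mk₀,
      Ext.comp_assoc_of_third_deg_zero]
  smul_zero a := Ext.zero_comp _ _ _ _ _
  smul_add a e e' := Ext.add_comp _ _ _ _
  add_smul a b e := by
    rw [smul_def, leftMul_add, Ext.mk₀_add, Ext.comp_add]; rfl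
  zero_smul e := by
    have h : leftMul (0 : C) = 0 :=
      ModuleCat.hom_ext (LinearMap.ext fun x : C => zero_mul x)
    rw [smul_def, h, Ext.mk₀_zero, Ext.comp_zero]

instance : Module Cᵐᵒᵖ (ExtBimodule k C) where
  one_smul e := by rw [op_smul_def, unop_one, dualLeftMul_one, Ext.mk₀_id_comp]
  mul_smul a b e := by
    rw [op_smul_def, op_smul_def, op_smul_def, unop_mul, dualLeftMul_mul, Ext.mk₀_comp_mk₀_assoc]
  smul_zero a := Ext.comp_zero _ _ _ _ _
  smul_add a e e' := Ext.comp_add _ _ _ _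
  add_smul a b e := by
    rw [op_smul_def, MulOpposite.unop_add, dualLeftMul_add, Ext.mk₀_add, Ext.add_comp]; rfl
  zero_smul e := by
    have h : dualLeftMul k (0 : C) = 0 :=
      ModuleCat.hom_ext (LinearMap.ext fun f : StdDual k C => StdDual.ext fun x =>
        (congrArg f (mul_zero x)).trans (map_zero (show C →ₗ[k] k from f)))
    rw [op_smul_def, unop_zero, h, Ext.mk₀_zero, Ext.zero_comp]

instance : SMulCommClass C Cᵐᵒᵖ (ExtBimodule k C) where
  smul_comm a b e := by
    simp only [smul_def, op_smul_def]
    exact Ext.comp_assoc_of_third_deg_zero _ _ _ _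

instance : IsScalarTower k C (ExtBimodule k C) where
  smul_assoc r a e := by
    rw [smul_def, smul_def, mk₀_leftMul_smul, Ext.comp_smul]

instance : IsScalarTower k Cᵐᵒᵖ (ExtBimodule k C) where
  smul_assoc r a e := by
    rw [op_smul_def, op_smul_def, unop_smul, mk₀_dualLeftMul_smul, Ext.smul_comp]

end ExtBimodule

/-- `Ext` groups of finitely generated modules over a finite-dimensional algebra are
finite-dimensional. -/
theorem finite_ext (R : Type u) [Ring R] [Algebra k R] [Module.Finite k R] (N M : ModuleCat.{u} R)
    [Module.Finite R N] [Module.Finite R M] (i : ℕ) : Module.Finite k (Ext.{u} N M i) := by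
  open scoped ModuleCat in
  have : IsNoetherianRing R := IsNoetherianRing.of_finite k R
  induction i generalizing N with
  | zero =>
    have : Module.Finite k N := Module.Finite.trans R N
    have : Module.Finite k M := Module.Finite.trans R M
    let φ : (N ⟶ M) →ₗ[k] (N →ₗ[k] M) :=
      { toFun := fun f => f.hom.restrictScalars k
        map_add' := fun _ _ => rfl
        map_smul' := fun _ _ => rfl }
    have hφ : Function.Injective φ := fun f g h =>
      ModuleCat.hom_ext (LinearMap.ext fun x => LinearMap.congr_fun h x)
    have : Module.Finite k (N ⟶ M) := Module.Finite.of_injective φ hφ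
    exact Module.Finite.equiv (Ext.linearEquiv₀ (R := k)).symm
  | succ n ih =>
    obtain ⟨m, f, surjf⟩ := Module.Finite.exists_fin' R N
    let exac := LinearMap.shortExact_shortComplexKer surjf
    exact Module.Finite.of_surjective (exac.extClass.precompOfLinear k M (add_comm 1 n))
      (precomp_extClass_surjective_of_projective_X₂ M exac n)

section FiniteDimensional

variable [Module.Finite k C]

instance : Module.Finite k (StdDual k C) := inferInstanceAs (Module.Finite k (C →ₗ[k] k))

instance : Module.Finite k (ExtBimodule k C) := by
  have : Module.Finite Cᵐᵒᵖ (StdDual k C) := Module.Finite.of_restrictScalars_finite k _ _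
  have : Module.Finite Cᵐᵒᵖ (dualModule k C) := this
  have : Module.Finite Cᵐᵒᵖ (regularModule C) := 
    Module.Finite.of_surjective (LinearMap.toSpanSingleton Cᵐᵒᵖ C 1) fun c =>
      ⟨MulOpposite.op c, one_mul c⟩
  exact finite_ext k Cᵐᵒᵖ _ _ 2

end FiniteDimensional

/-- The relation extension `B = C ⋉ E` with `E = Ext²_C(DC, C)`: the `k`-algebra `C ⊕ E` with product
`(c, e)(c', e') = (c c', c e' + e c')`. -/
abbrev RelExt : Type u := TrivSqZeroExt C (ExtBimodule k C)

instance [Module.Finite k C] : Module.Finite k (RelExt k C) :=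
  inferInstanceAs (Module.Finite k (C × ExtBimodule k C))

/-- The standard embedding of right `C`-modules into right `B`-modules: `B` acts on `M` through the
projection `B → C`, that is, `m (c, e) = m c`. -/
abbrev toRelExt : ModuleCat.{u} Cᵐᵒᵖ ⥤ ModuleCat.{u} (RelExt k C)ᵐᵒᵖ :=
  ModuleCat.restrictScalars
    (TrivSqZeroExt.fstHom k C (ExtBimodule k C)).toRingHom.op

instance (M : ModuleCat.{u} Cᵐᵒᵖ) [Module.Finite Cᵐᵒᵖ M] :
    Module.Finite (RelExt k C)ᵐᵒᵖ ((toRelExt k C).obj M) := by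
  obtain ⟨s, hs⟩ := Module.Finite.fg_top (R := Cᵐᵒᵖ) (M := M)
  let N : ModuleCat.{u} (RelExt k C)ᵐᵒᵖ := (toRelExt k C).obj M
  let t : Finset N := s
  have key : ∀ x : M, x ∈ Submodule.span Cᵐᵒᵖ (s : Set M) →
      (id x : N) ∈ Submodule.span (RelExt k C)ᵐᵒᵖ (t : Set N) := by
    intro x hx
    induction hx using Submodule.span_induction with
    | mem x hx => exact Submodule.subset_span hx
    | zero => exact Submodule.zero_mem _
    | add x y _ _ hx hy => exact Submodule.add_mem _ hx hy
    | smul c x _ hx =>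
      exact Submodule.smul_mem _ (MulOpposite.op (TrivSqZeroExt.inl c.unop)) hx
  exact ⟨⟨t, eq_top_iff.2 fun x _ => key x (hs ▸ Submodule.mem_top)⟩⟩

end Bimodule

end

end RelationExtension

namespace RelationExtension

noncomputable section

open MulOpposite (op)

/-! ### Superfluous submodules and uniqueness of minimal projective presentations -/

section Superfluous

variable {R P P' N : Type u} [Ring R] [AddCommGroup P] [Module R P] [AddCommGroup P']
  [Module R P'] [AddCommGroup N] [Module R N]

theorem IsSuperfluous.mono {K L : Submodule R P} (hL : IsSuperfluous L) (h : K ≤ L) :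
    IsSuperfluous K := fun N hN =>
  hL N (top_le_iff.1 (hN ▸ sup_le_sup_left h N))

theorem IsSuperfluous.sup {K L : Submodule R P} (hK : IsSuperfluous K) (hL : IsSuperfluous L) :
    IsSuperfluous (K ⊔ L) := fun N hN =>
  hK N (hL _ (by rwa [sup_assoc]))

theorem IsSuperfluous.map {K : Submodule R P} (hK : IsSuperfluous K) (f : P →ₗ[R] P') :
    IsSuperfluous (K.map f) := by
  intro N hN
  have h : N.comap f ⊔ K = ⊤ := by
    rw [eq_top_iff]
    intro x _
    obtain ⟨n, hn, _, ⟨y, hy, rfl⟩, hxy⟩ := Submodule.mem_sup.1 (hN ▸ Submodule.mem_top (x := f x))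
    refine Submodule.mem_sup.2 ⟨x - y, ?_, y, hy, sub_add_cancel _ _⟩
    rw [Submodule.mem_comap, map_sub, ← hxy, add_sub_cancel_right]
    exact hn
  have h' : K.map f ≤ N := by
    rw [Submodule.map_le_iff_le_comap, hK _ h]
    exact le_top
  rw [← hN, sup_eq_left.2 h']

theorem IsSuperfluous.prod {K : Submodule R P} {L : Submodule R P'} (hK : IsSuperfluous K)
    (hL : IsSuperfluous L) : IsSuperfluous (K.prod L) := by
  refine ((hK.map (LinearMap.inl R P P')).sup (hL.map (LinearMap.inr R P P'))).mono ?_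
  rintro ⟨x, y⟩ ⟨hx, hy⟩
  exact Submodule.mem_sup.2
    ⟨_, Submodule.mem_map_of_mem hx, _, Submodule.mem_map_of_mem hy, by simp⟩

/-- A map between projective covers of the same submodule lifts to an isomorphism. -/
theorem exists_equiv_of_isSuperfluous_ker [Module.Projective R P] [Module.Projective R P']
    (p : P →ₗ[R] N) (p' : P' →ₗ[R] N) (h : LinearMap.range p = LinearMap.range p')
    (hp : IsSuperfluous (LinearMap.ker p)) (hp' : IsSuperfluous (LinearMap.ker p')) :
    ∃ e : P ≃ₗ[R] P', p' ∘ₗ e.toLinearMap = p := by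
  obtain ⟨f, hf⟩ := Module.projective_lifting_property p'.rangeRestrict
    (p.codRestrict (LinearMap.range p') fun x => h ▸ LinearMap.mem_range_self p x)
    p'.surjective_rangeRestrict
  replace hf : ∀ x, p' (f x) = p x := fun x => congrArg Subtype.val (LinearMap.congr_fun hf x)
  have hfs : LinearMap.range f = ⊤ := by
    refine hp' _ (eq_top_iff.2 fun y _ => ?_)
    obtain ⟨x, hx⟩ : p' y ∈ LinearMap.range p := h ▸ LinearMap.mem_range_self p' y
    refine Submodule.mem_sup.2 ⟨f x, LinearMap.mem_range_self f x, y - f x, ?_, by abel⟩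
    rw [LinearMap.mem_ker, map_sub, hf, hx, sub_self]
  obtain ⟨s, hs⟩ := Module.projective_lifting_property f .id (LinearMap.range_eq_top.1 hfs)
  replace hs : ∀ y, f (s y) = y := LinearMap.congr_fun hs
  have hss : LinearMap.range s = ⊤ := by
    refine hp _ (eq_top_iff.2 fun x _ => ?_)
    refine Submodule.mem_sup.2 ⟨s (f x), LinearMap.mem_range_self s _, x - s (f x), ?_, by abel⟩
    rw [LinearMap.mem_ker, map_sub, ← hf, ← hf (s _), hs, sub_self]
  have hinj : Function.Injective f := by
    intro x x' hxx
    obtain ⟨y, rfl⟩ := LinearMap.range_eq_top.1 hss x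
    obtain ⟨y', rfl⟩ := LinearMap.range_eq_top.1 hss x'
    rw [hs, hs] at hxx
    rw [hxx]
  exact ⟨LinearEquiv.ofBijective f ⟨hinj, LinearMap.range_eq_top.1 hfs⟩, LinearMap.ext hf⟩

end Superfluous

section Transpose

variable {A M : Type u} [Ring A] [AddCommGroup M] [Module Aᵐᵒᵖ M]

/-- The isomorphism `Hom_A(Q, A) ≃ Hom_A(P, A)` induced by an isomorphism `P ≃ Q`. -/
def homDualEquiv {P Q : Type u} [AddCommGroup P] [AddCommGroup Q] [Module Aᵐᵒᵖ P]
    [Module Aᵐᵒᵖ Q] (e : P ≃ₗ[Aᵐᵒᵖ] Q) : (Q →ₗ[Aᵐᵒᵖ] A) ≃ₗ[A] (P →ₗ[Aᵐᵒᵖ] A) :=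
  LinearEquiv.ofLinearMap (homDual e.toLinearMap) (homDual e.symm.toLinearMap)
    (LinearMap.ext fun f => LinearMap.ext fun x => congrArg f (e.symm_apply_apply x))
    (LinearMap.ext fun f => LinearMap.ext fun x => congrArg f (e.apply_symm_apply x))

/-- The transpose does not depend on the choice of the minimal projective presentation. -/
theorem nonempty_transpose_equiv (P P' : MinProjPresentation Aᵐᵒᵖ M) :
    Nonempty (transpose P ≃ₗ[A] transpose P') := by
  have := P.projective₀
  have := P.projective₁
  have := P'.projective₀
  have := P'.projective₁
  obtain ⟨e₀, he₀⟩ := exists_equiv_of_isSuperfluous_ker P.d₀ P'.d₀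
    (by rw [LinearMap.range_eq_top.2 P.surjective, LinearMap.range_eq_top.2 P'.surjective])
    P.minimal₀ P'.minimal₀
  obtain ⟨e₁, he₁⟩ := exists_equiv_of_isSuperfluous_ker (e₀.toLinearMap ∘ₗ P.d₁) P'.d₁
    (by
      rw [LinearMap.range_comp, P.exact, P'.exact, ← he₀, LinearMap.ker_comp,
        Submodule.map_comap_eq_of_surjective e₀.surjective])
    (by rw [LinearMap.ker_comp_of_ker_eq_bot _ (LinearEquiv.ker e₀)]; exact P.minimal₁) P'.minimal₁
  refine ⟨Submodule.Quotient.equiv _ _ (homDualEquiv e₁.symm) ?_⟩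
  have hcomm : ∀ f : P'.P₀ →ₗ[Aᵐᵒᵖ] A,
      homDualEquiv e₁.symm (homDual P.d₁ (homDualEquiv e₀ f)) = homDual P'.d₁ f := by
    intro f
    refine LinearMap.ext fun y => ?_
    obtain ⟨x, rfl⟩ := e₁.surjective y
    change f (e₀ (P.d₁ (e₁.symm (e₁ x)))) = f (P'.d₁ (e₁ x))
    rw [e₁.symm_apply_apply]
    exact congrArg f (LinearMap.congr_fun he₁ x).symm
  ext f
  constructor
  · rintro ⟨_, ⟨g, rfl⟩, rfl⟩
    refine ⟨(homDualEquiv e₀).symm g, ?_⟩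
    rw [← hcomm, LinearEquiv.apply_symm_apply]
    rfl
  · rintro ⟨g, rfl⟩
    exact ⟨_, ⟨homDualEquiv e₀ g, rfl⟩, hcomm g⟩

end Transpose

/-! ### Dual bases of finitely generated projective right modules -/

section DualBasis

variable {C P : Type u} [Ring C] [AddCommGroup P] [Module Cᵐᵒᵖ P]

/-- The map of right modules `C → P`, `c ↦ x c`. -/
def pointMap (x : P) : C →ₗ[Cᵐᵒᵖ] P where
  toFun c := MulOpposite.op c • x
  map_add' a b := by rw [MulOpposite.op_add, add_smul]
  map_smul' a c := by
    rw [RingHom.id_apply, ← mul_smul]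
    rfl

theorem exists_dualBasis (C P : Type u) [Ring C] [AddCommGroup P] [Module Cᵐᵒᵖ P]
    [Module.Finite Cᵐᵒᵖ P] [Module.Projective Cᵐᵒᵖ P] :
    ∃ (n : ℕ) (p : Fin n → P) (f : Fin n → (P →ₗ[Cᵐᵒᵖ] C)),
      ∑ i, pointMap (p i) ∘ₗ f i = LinearMap.id := by
  obtain ⟨n, s, t, -, -, hst⟩ := Module.Finite.exists_comp_eq_id_of_projective Cᵐᵒᵖ P
  let u : Cᵐᵒᵖ →ₗ[Cᵐᵒᵖ] C :=
    { toFun := MulOpposite.unop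
      map_add' := fun _ _ => rfl
      map_smul' := fun _ _ => rfl }
  refine ⟨n, fun i => s fun j => if i = j then 1 else 0, fun i => u ∘ₗ LinearMap.proj i ∘ₗ t, ?_⟩
  refine LinearMap.ext fun x => ?_
  rw [LinearMap.sum_apply]
  conv_rhs => rw [← hst, LinearMap.comp_apply, LinearMap.pi_apply_eq_sum_univ s]
  rfl

end DualBasis

/-! ### `Ext` over algebras of global dimension two -/

section Exactness

variable {R : Type u} [Ring R] {X Y Z : ModuleCat.{u} R}

/-- The short exact sequence `0 → X → Y → Y / X → 0`. -/
theorem shortExact_mkQ {X Y : Type u} [AddCommGroup X] [Module R X] [AddCommGroup Y] [Module R Y]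
    (f : X →ₗ[R] Y) (hf : Function.Injective f) :
    (ModuleCat.shortComplexOfCompEqZero f (LinearMap.range f).mkQ
      f.exact_map_mkQ_range.linearMap_comp_eq_zero).ShortExact :=
  ModuleCat.shortComplex_shortExact _ f.exact_map_mkQ_range hf (Submodule.mkQ_surjective _)

/-- `Extⁿ(-, W)` is right exact if `Extⁿ⁺¹(-, W)` vanishes. -/
theorem Ext.precomp_surjective_of_injective {n : ℕ} (W : ModuleCat.{u} R)
    (hW : ∀ X : ModuleCat.{u} R, Subsingleton (Ext.{u} X W (1 + n))) (f : X ⟶ Y)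
    (hf : Function.Injective f.hom) (x : Ext.{u} X W n) :
    ∃ y : Ext.{u} Y W n, (Ext.mk₀ f).comp y (zero_add n) = x :=
  Ext.contravariant_sequence_exact₁ (shortExact_mkQ f.hom hf) W x rfl
    (Subsingleton.elim (h := hW _) _ _)

theorem Ext.exists_of_precomp_eq_zero {n : ℕ} (W : ModuleCat.{u} R)
    (hW : ∀ X : ModuleCat.{u} R, Subsingleton (Ext.{u} X W (1 + n))) (f : X ⟶ Y) (g : Y ⟶ Z)
    (hf : Function.Injective f.hom) (hfg : Function.Exact f.hom g.hom) (y : Ext.{u} Y W n)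
    (hy : (Ext.mk₀ f).comp y (zero_add n) = 0) :
    ∃ z : Ext.{u} Z W n, (Ext.mk₀ g).comp z (zero_add n) = y := by
  obtain ⟨q, hq⟩ := Ext.contravariant_sequence_exact₂ (shortExact_mkQ f.hom hf) W y hy
  have hker : LinearMap.ker g.hom = LinearMap.range f.hom := LinearMap.exact_iff.1 hfg
  let h : ModuleCat.of R (Y ⧸ LinearMap.range f.hom) ⟶ Z :=
    ModuleCat.ofHom ((LinearMap.range f.hom).liftQ g.hom hker.ge)
  have hh : Function.Injective h.hom :=
    LinearMap.ker_eq_bot.1 (Submodule.ker_liftQ_eq_bot _ _ _ hker.le)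
  obtain ⟨z, hz⟩ := Ext.precomp_surjective_of_injective W hW h hh q
  refine ⟨z, ?_⟩
  have hg : g = ModuleCat.ofHom (LinearMap.range f.hom).mkQ ≫ h :=
    ModuleCat.hom_ext (LinearMap.ext fun _ => rfl)
  rw [hg, ← Ext.mk₀_comp_mk₀_assoc, hz]
  exact hq

/-- `Extⁿ(W, -)` is right exact if `Extⁿ⁺¹(W, -)` vanishes. -/
theorem Ext.postcomp_surjective_of_surjective {n : ℕ} (W : ModuleCat.{u} R)
    (hW : ∀ X : ModuleCat.{u} R, Subsingleton (Ext.{u} W X (n + 1))) (g : Y ⟶ Z)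
    (hg : Function.Surjective g.hom) (z : Ext.{u} W Z n) :
    ∃ y : Ext.{u} W Y n, y.comp (Ext.mk₀ g) (add_zero n) = z :=
  Ext.covariant_sequence_exact₃ W (LinearMap.shortExact_shortComplexKer hg) z rfl
    (Subsingleton.elim (h := hW _) _ _)

theorem Ext.exists_of_postcomp_eq_zero {n : ℕ} (W : ModuleCat.{u} R)
    (hW : ∀ X : ModuleCat.{u} R, Subsingleton (Ext.{u} W X (n + 1))) (f : X ⟶ Y) (g : Y ⟶ Z)
    (hg : Function.Surjective g.hom) (hfg : LinearMap.range f.hom = LinearMap.ker g.hom)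
    (y : Ext.{u} W Y n) (hy : y.comp (Ext.mk₀ g) (add_zero n) = 0) :
    ∃ x : Ext.{u} W X n, x.comp (Ext.mk₀ f) (add_zero n) = y := by
  obtain ⟨q, hq⟩ :=
    Ext.covariant_sequence_exact₂ W (LinearMap.shortExact_shortComplexKer hg) y hy
  let h : X ⟶ ModuleCat.of R (LinearMap.ker g.hom) :=
    ModuleCat.ofHom (f.hom.codRestrict _ fun x => hfg ▸ LinearMap.mem_range_self _ x)
  have hh : Function.Surjective h.hom := by
    rintro ⟨y, hy⟩
    obtain ⟨x, rfl⟩ := hfg.symm ▸ hy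
    exact ⟨x, rfl⟩
  obtain ⟨x, hx⟩ := Ext.postcomp_surjective_of_surjective W hW h hh q
  refine ⟨x, ?_⟩
  rw [← hq, ← hx, Ext.comp_assoc_of_third_deg_zero, Ext.mk₀_comp_mk₀]
  rfl

/-- A module `M` has injective dimension at most one if `Ext²(-, M)` vanishes on cyclic modules. -/
theorem hasInjectiveDimensionLT_two_of_cyclic (M : ModuleCat.{u} R)
    (h : ∀ J : Ideal R, Subsingleton (Ext.{u} (ModuleCat.of R (R ⧸ J)) M 2)) :
    HasInjectiveDimensionLT M 2 := by
  let ⟨I, _, f, _⟩ := EnoughInjectives.presentation M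
  have exactS := shortExact_mkQ f.hom ((ModuleCat.mono_iff_injective f).1 ‹_›)
  refine (exactS.hasInjectiveDimensionLT_X₃_iff 0 ‹_›).1 ?_
  rw [zero_add, ← injective_iff_hasInjectiveDimensionLT_one]
  refine (Module.injective_iff_injective_object R _).1 (Module.Baer.injective fun J g => ?_)
  have hJ := LinearMap.shortExact_shortComplexKer (Submodule.mkQ_surjective J)
  let i : ModuleCat.of R (LinearMap.ker J.mkQ) ⟶ ModuleCat.of R J :=
    ModuleCat.ofHom (Submodule.inclusion (Submodule.ker_mkQ J).le)
  have hzero : ∀ e : Ext.{u} (ModuleCat.of R (R ⧸ J))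
      (ModuleCat.of R (I ⧸ LinearMap.range f.hom)) 1,
      e = 0 := by
    intro e
    obtain ⟨e', rfl⟩ := Ext.covariant_sequence_exact₃ _ exactS e (n₁ := 2) rfl
      (Subsingleton.elim (h := h J) _ _)
    rw [Ext.eq_zero_of_injective e', Ext.zero_comp]
  obtain ⟨y, hy⟩ := Ext.contravariant_sequence_exact₁ hJ _ (Ext.mk₀ (i ≫ ModuleCat.ofHom g))
    (add_zero 1) (hzero _)
  obtain ⟨y, rfl⟩ := (Ext.mk₀_bijective _ _).2 y
  rw [Ext.mk₀_comp_mk₀, (Ext.mk₀_bijective _ _).1.eq_iff] at hy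
  refine ⟨y.hom, fun x hx => ?_⟩
  exact LinearMap.congr_fun (congrArg ModuleCat.Hom.hom hy) ⟨x, (Submodule.ker_mkQ J).ge hx⟩

/-- A finitely generated module `N` over a noetherian ring has projective dimension at most one if
`Ext²(N, -)` vanishes on finitely generated modules. -/
theorem hasProjectiveDimensionLT_two_of_finite [IsNoetherianRing R] (N : ModuleCat.{u} R)
    [Module.Finite R N]
    (h : ∀ X : ModuleCat.{u} R, Module.Finite R X → Subsingleton (Ext.{u} N X 2)) :
    HasProjectiveDimensionLT N 2 := by
  obtain ⟨n, f, hf⟩ := Module.Finite.exists_fin' R N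
  have hS := LinearMap.shortExact_shortComplexKer hf
  have hproj : ∀ n : ℕ, Projective (ModuleCat.of R (Fin n → R)) := fun n =>
    (IsProjective.iff_projective _).1 inferInstance
  refine (hS.hasProjectiveDimensionLT_X₃_iff 0 (hproj n)).2 ?_
  rw [zero_add, ← projective_iff_hasProjectiveDimensionLT_one]
  obtain ⟨m, g, hg⟩ := Module.Finite.exists_fin' R (LinearMap.ker f)
  have hS' := LinearMap.shortExact_shortComplexKer hg
  have hzero : ∀ e : Ext.{u} (ModuleCat.of R (LinearMap.ker f))
      (ModuleCat.of R (LinearMap.ker g)) 1, e = 0 := by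
    intro e
    have := h (ModuleCat.of R (LinearMap.ker g))
      (inferInstanceAs (Module.Finite R (LinearMap.ker g)))
    obtain ⟨e', rfl⟩ := Ext.contravariant_sequence_exact₁ hS _ e (n₁ := 2) rfl
      (Subsingleton.elim _ _)
    have := hproj n
    rw [Ext.eq_zero_of_projective e', Ext.comp_zero]
  obtain ⟨s, hs⟩ := Ext.covariant_sequence_exact₃ _ hS' (Ext.mk₀ (𝟙 _)) (zero_add 1) (hzero _)
  obtain ⟨s, rfl⟩ := (Ext.mk₀_bijective _ _).2 s
  rw [Ext.mk₀_comp_mk₀, (Ext.mk₀_bijective _ _).1.eq_iff] at hs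
  have := hproj m
  exact (Retract.mk s (ModuleCat.ofHom g) hs).projective

theorem sum_single_comp_proj (R : Type u) [Ring R] {ι : Type} [Fintype ι] [DecidableEq ι]
    (X : ι → Type u) [∀ i, AddCommGroup (X i)] [∀ i, Module R (X i)] :
    ∑ i, LinearMap.single R X i ∘ₗ LinearMap.proj i = LinearMap.id := by
  refine LinearMap.ext fun x => ?_
  rw [LinearMap.sum_apply]
  exact Finset.univ_sum_single x

/-- `Ext(-, W)` vanishes on retracts of finite powers. -/
theorem Ext.subsingleton_of_sum_eq_id {n : ℕ} {ι : Type} [Fintype ι] (W : ModuleCat.{u} R)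
    (f : ι → (X ⟶ Y)) (g : ι → (Y ⟶ X)) (h : ∑ i, f i ≫ g i = 𝟙 X)
    (hY : Subsingleton (Ext.{u} Y W n)) : Subsingleton (Ext.{u} X W n) := by
  refine subsingleton_of_forall_eq 0 fun e => ?_
  rw [← Ext.mk₀_id_comp e, ← h, Ext.mk₀_sum, Ext.sum_comp]
  refine Finset.sum_eq_zero fun i _ => ?_
  rw [← Ext.mk₀_comp_mk₀_assoc, Subsingleton.elim ((Ext.mk₀ (g i)).comp e _) 0, Ext.comp_zero]

theorem Ext.subsingleton_of_sum_eq_id' {n : ℕ} {ι : Type} [Fintype ι] (W : ModuleCat.{u} R)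
    (f : ι → (X ⟶ Y)) (g : ι → (Y ⟶ X)) (h : ∑ i, f i ≫ g i = 𝟙 X)
    (hY : Subsingleton (Ext.{u} W Y n)) : Subsingleton (Ext.{u} W X n) := by
  refine subsingleton_of_forall_eq 0 fun e => ?_
  rw [← Ext.comp_mk₀_id e, ← h, Ext.mk₀_sum, Ext.comp_sum]
  refine Finset.sum_eq_zero fun i _ => ?_
  rw [← Ext.mk₀_comp_mk₀, ← Ext.comp_assoc_of_third_deg_zero,
    Subsingleton.elim (e.comp (Ext.mk₀ (f i)) _) 0, Ext.zero_comp]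

end Exactness

section GlobalDimension

variable {C : Type u} [Ring C]

theorem subsingleton_ext_three (hC : globalDimension C = 2) (X Y : ModuleCat.{u} Cᵐᵒᵖ) :
    Subsingleton (Ext.{u} X Y 3) := by
  have h : projectiveDimension X ≤ (2 : ℕ) :=
    (le_iSup (fun X : ModuleCat.{u} Cᵐᵒᵖ => projectiveDimension X) X).trans hC.le
  rw [projectiveDimension_le_iff] at h
  exact HasProjectiveDimensionLT.subsingleton X 3 3 le_rfl Y

variable (k : Type u) [Field k] [Algebra k C] [Module.Finite k C]

/-- Finitely generated modules embed into finite powers of the injective cogenerator `DC`. -/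
theorem exists_injective_to_dualModule (X : Type u) [AddCommGroup X] [Module Cᵐᵒᵖ X]
    [Module.Finite Cᵐᵒᵖ X] :
    ∃ (n : ℕ) (f : X →ₗ[Cᵐᵒᵖ] (Fin n → StdDual k C)), Function.Injective f := by
  let _ : Module k X := Module.compHom X (algebraMap k Cᵐᵒᵖ)
  have : IsScalarTower k Cᵐᵒᵖ X := ⟨fun a b x => by
    rw [Algebra.smul_def, mul_smul]; rfl⟩
  have : Module.Finite k X := Module.Finite.trans Cᵐᵒᵖ X
  let b := Module.finBasis k X
  let g : Fin (Module.finrank k X) → (X →ₗ[Cᵐᵒᵖ] StdDual k C) := fun i =>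
    { toFun := fun x =>
        { toFun := fun c => b.coord i (MulOpposite.op c • x)
          map_add' := fun c d => by rw [MulOpposite.op_add, add_smul, map_add]
          map_smul' := fun r c => by
            rw [MulOpposite.op_smul, smul_assoc, map_smul, RingHom.id_apply] }
      map_add' := fun x y => StdDual.ext fun c =>
        (congrArg (b.coord i) (smul_add _ x y)).trans (map_add _ _ _)
      map_smul' := fun a x => StdDual.ext fun c =>
        congrArg (b.coord i) (mul_smul (MulOpposite.op c) a x).symm }
  refine ⟨_, LinearMap.pi g, fun x y hxy => b.repr.injective (Finsupp.ext fun i => ?_)⟩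
  have h : b.coord i (MulOpposite.op (1 : C) • x) = b.coord i (MulOpposite.op (1 : C) • y) :=
    DFunLike.congr_fun (F := StdDual k C) (congrFun hxy i) 1
  rwa [MulOpposite.op_one, one_smul, one_smul] at h

theorem injectiveDimension_le_one_iff (hC : globalDimension C = 2) (M : ModuleCat.{u} Cᵐᵒᵖ) :
    injectiveDimension M ≤ 1 ↔ Subsingleton (Ext.{u} (dualModule k C) M 2) := by
  refine (injectiveDimension_le_iff M 1).trans ⟨fun h => h.subsingleton M 2 2 le_rfl _, fun h => ?_⟩
  refine hasInjectiveDimensionLT_two_of_cyclic M fun J => ?_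
  obtain ⟨n, f, hf⟩ := exists_injective_to_dualModule (C := C) k (Cᵐᵒᵖ ⧸ J)
  have hpow : Subsingleton (Ext.{u} (ModuleCat.of Cᵐᵒᵖ (Fin n → StdDual k C)) M 2) := by
    refine Ext.subsingleton_of_sum_eq_id (Y := dualModule k C) M
      (fun i => ModuleCat.ofHom (LinearMap.proj i))
      (fun i => ModuleCat.ofHom (LinearMap.single Cᵐᵒᵖ (fun _ => StdDual k C) i)) ?_ h
    refine ModuleCat.hom_ext ?_
    rw [ModuleCat.hom_sum]
    exact sum_single_comp_proj Cᵐᵒᵖ fun _ => StdDual k C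
  refine subsingleton_of_forall_eq 0 fun e => ?_
  obtain ⟨y, rfl⟩ := Ext.precomp_surjective_of_injective M
    (fun X => subsingleton_ext_three hC X M) (ModuleCat.ofHom f) hf e
  rw [Subsingleton.elim y 0, Ext.comp_zero]

theorem projectiveDimension_le_one_iff (k : Type u) [Field k] [Algebra k C] [Module.Finite k C]
    (hC : globalDimension C = 2) (N : ModuleCat.{u} Cᵐᵒᵖ)
    [Module.Finite Cᵐᵒᵖ N] :
    projectiveDimension N ≤ 1 ↔ Subsingleton (Ext.{u} N (regularModule C) 2) := by
  refine (projectiveDimension_le_iff N 1).trans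
    ⟨fun h => h.subsingleton N 2 2 le_rfl _, fun h => ?_⟩
  have := IsArtinianRing.of_finite k Cᵐᵒᵖ
  refine hasProjectiveDimensionLT_two_of_finite N fun X hX => ?_
  obtain ⟨n, f, hf⟩ := Module.Finite.exists_fin' Cᵐᵒᵖ X
  have hpow : Subsingleton (Ext.{u} N (ModuleCat.of Cᵐᵒᵖ (Fin n → Cᵐᵒᵖ)) 2) := by
    let u : regularModule C ⟶ ModuleCat.of Cᵐᵒᵖ Cᵐᵒᵖ := ModuleCat.ofHom (pointMap (1 : Cᵐᵒᵖ))
    let v : ModuleCat.of Cᵐᵒᵖ Cᵐᵒᵖ ⟶ regularModule C :=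
      ModuleCat.ofHom (LinearMap.toSpanSingleton Cᵐᵒᵖ C 1)
    refine Ext.subsingleton_of_sum_eq_id' (Y := regularModule C) N
      (fun i => ModuleCat.ofHom (LinearMap.proj i) ≫ v)
      (fun i => u ≫ ModuleCat.ofHom (LinearMap.single Cᵐᵒᵖ (fun _ => Cᵐᵒᵖ) i)) ?_ h
    have huv : v ≫ u = 𝟙 _ := ModuleCat.hom_ext (LinearMap.ext fun c =>
      (mul_one _).trans (congrArg MulOpposite.op (one_mul c.unop)))
    refine ModuleCat.hom_ext ?_
    rw [ModuleCat.hom_sum, ModuleCat.hom_id, ← sum_single_comp_proj Cᵐᵒᵖ fun _ : Fin n => Cᵐᵒᵖ]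
    refine Finset.sum_congr rfl fun i _ => ?_
    rw [Category.assoc, reassoc_of% huv]
    rfl
  refine subsingleton_of_forall_eq 0 fun e => ?_
  obtain ⟨y, rfl⟩ := Ext.postcomp_surjective_of_surjective N
    (fun X => subsingleton_ext_three hC N X) (ModuleCat.ofHom f) hf e
  rw [Subsingleton.elim y 0, Ext.zero_comp]

end GlobalDimension

/-! ### The Nakayama functor and `Ext²(-, C)` -/

namespace StdDual

variable (k : Type u) {A X Y Z : Type u} [Field k] [Ring A] [Algebra k A]
  [AddCommGroup X] [Module k X] [Module A X] [IsScalarTower k A X]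
  [AddCommGroup Y] [Module k Y] [Module A Y] [IsScalarTower k A Y]
  [AddCommGroup Z] [Module k Z] [Module A Z] [IsScalarTower k A Z]

/-- The map of right modules `D Y → D X` dual to a map of left modules `X → Y`. -/
def map (f : X →ₗ[A] Y) : StdDual k Y →ₗ[Aᵐᵒᵖ] StdDual k X where
  toFun g := LinearMap.comp (show Y →ₗ[k] k from g) (f.restrictScalars k)
  map_add' _ _ := rfl
  map_smul' a g := StdDual.ext fun x => congrArg g (f.map_smul a.unop x).symm

theorem map_add (f g : X →ₗ[A] Y) : map k (f + g) = map k f + map k g :=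
  LinearMap.ext fun h => StdDual.ext fun x => LinearMap.map_add (show Y →ₗ[k] k from h) (f x) (g x)

theorem map_zero : map k (0 : X →ₗ[A] Y) = 0 :=
  LinearMap.ext fun h => StdDual.ext fun _ => LinearMap.map_zero (show Y →ₗ[k] k from h)

theorem map_sum {ι : Type} (s : Finset ι) (f : ι → (X →ₗ[A] Y)) :
    map k (∑ i ∈ s, f i) = ∑ i ∈ s, map k (f i) :=
  _root_.map_sum (⟨⟨map k, map_zero k⟩, map_add k⟩ : (X →ₗ[A] Y) →+ _) f s

theorem map_injective {f : X →ₗ[A] Y} (hf : Function.Surjective f) :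
    Function.Injective (map k f) := fun g h hgh => StdDual.ext fun y => by
  obtain ⟨x, rfl⟩ := hf y
  exact DFunLike.congr_fun (F := StdDual k X) hgh x

theorem map_exact (f : X →ₗ[A] Y) :
    Function.Exact (map k (LinearMap.range f).mkQ) (map k f) := by
  intro g
  constructor
  · intro hg
    refine ⟨((LinearMap.range f).restrictScalars k).liftQ (show Y →ₗ[k] k from g) ?_, rfl⟩
    rintro _ ⟨x, rfl⟩
    exact DFunLike.congr_fun (F := StdDual k X) hg x
  · rintro ⟨h, rfl⟩
    refine StdDual.ext fun x => ?_
    have : (LinearMap.range f).mkQ (f x) = 0 :=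
      (Submodule.Quotient.mk_eq_zero _).2 (LinearMap.mem_range_self f x)
    exact (congrArg h this).trans (LinearMap.map_zero (show _ →ₗ[k] k from h))

end StdDual

section Nakayama

variable (k : Type u) {C P Q : Type u} [Field k] [Ring C] [Algebra k C]
  [AddCommGroup P] [Module Cᵐᵒᵖ P] [AddCommGroup Q] [Module Cᵐᵒᵖ Q]

/-- Evaluation `Hom_C(P, C) → C` at `x`, a map of left modules. -/
def evalAt (x : P) : (P →ₗ[Cᵐᵒᵖ] C) →ₗ[C] C where
  toFun f := f x
  map_add' _ _ := rfl
  map_smul' _ _ := rfl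

/-- The map of left modules `C → Hom_C(P, C)`, `c ↦ c f`. -/
def spanDual (f : P →ₗ[Cᵐᵒᵖ] C) : C →ₗ[C] (P →ₗ[Cᵐᵒᵖ] C) := LinearMap.toSpanSingleton C _ f

/-- The Nakayama functor `P ↦ D Hom_C(P, C)`. -/
abbrev nakayama (P : Type u) [AddCommGroup P] [Module Cᵐᵒᵖ P] : ModuleCat.{u} Cᵐᵒᵖ :=
  ModuleCat.of Cᵐᵒᵖ (StdDual k (P →ₗ[Cᵐᵒᵖ] C))

/-- The Nakayama functor on maps. -/
abbrev nakayamaMap (d : P →ₗ[Cᵐᵒᵖ] Q) : nakayama k P ⟶ nakayama (C := C) k Q :=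
  ModuleCat.ofHom (StdDual.map k (homDual d))

/-- The map `DC → D Hom_C(P, C)` dual to evaluation at `x`. -/
def coevalAt (x : P) : dualModule k C ⟶ nakayama k P := ModuleCat.ofHom (StdDual.map k (evalAt x))

theorem coevalAt_add (x y : P) : coevalAt (C := C) k (x + y) = coevalAt k x + coevalAt k y := by
  refine ModuleCat.hom_ext ((congrArg (StdDual.map k) ?_).trans (StdDual.map_add k _ _))
  exact LinearMap.ext fun f => f.map_add x y

theorem coevalAt_smul (c : Cᵐᵒᵖ) (x : P) :
    coevalAt (C := C) k (c • x) = dualLeftMul k c.unop ≫ coevalAt k x :=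
  ModuleCat.hom_ext (LinearMap.ext fun g => StdDual.ext fun f => congrArg g (f.map_smul c x))

/-- The natural map `Ext²(D Hom_C(P, C), C) → Hom_C(P, Ext²(DC, C))`. -/
def nakayamaExt (w : Ext.{u} (nakayama (C := C) k P) (regularModule C) 2) :
    P →ₗ[Cᵐᵒᵖ] ExtBimodule k C where
  toFun x := (Ext.mk₀ (coevalAt k x)).comp w (zero_add 2)
  map_add' x y := by rw [coevalAt_add, Ext.mk₀_add, Ext.add_comp]
  map_smul' c x := by
    rw [coevalAt_smul, RingHom.id_apply, ExtBimodule.op_smul_def, Ext.mk₀_comp_mk₀_assoc]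

theorem nakayamaExt_precomp (d : P →ₗ[Cᵐᵒᵖ] Q)
    (w : Ext.{u} (nakayama (C := C) k Q) (regularModule C) 2) :
    nakayamaExt k ((Ext.mk₀ (nakayamaMap k d)).comp w (zero_add 2)) = nakayamaExt k w ∘ₗ d :=
  LinearMap.ext fun _ => Ext.mk₀_comp_mk₀_assoc _ _ _

theorem nakayamaExt_bijective [Module.Finite Cᵐᵒᵖ P] [Module.Projective Cᵐᵒᵖ P] :
    Function.Bijective (nakayamaExt k (C := C) (P := P)) := by
  obtain ⟨n, p, f, hpf⟩ := exists_dualBasis C P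
  let g : Fin n → (nakayama k P ⟶ dualModule k C) := fun i =>
    ModuleCat.ofHom (StdDual.map k (spanDual (f i)))
  have hid : ∑ i, g i ≫ coevalAt k (p i) = 𝟙 (nakayama (C := C) k P) := by
    refine ModuleCat.hom_ext ?_
    rw [ModuleCat.hom_sum]
    refine (StdDual.map_sum k Finset.univ fun i => spanDual (f i) ∘ₗ evalAt (p i)).symm.trans
      (congrArg (StdDual.map k) (a₂ := LinearMap.id) ?_)
    refine LinearMap.ext fun h => LinearMap.ext fun x => ?_
    conv_rhs => rw [LinearMap.id_apply, ← LinearMap.id_apply (R := Cᵐᵒᵖ) x, ← hpf]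
    rw [LinearMap.sum_apply, LinearMap.sum_apply, LinearMap.sum_apply, _root_.map_sum]
    refine Finset.sum_congr rfl fun i _ => ?_
    exact (h.map_smul (MulOpposite.op (f i x)) (p i)).symm
  constructor
  · intro w w' hw
    rw [← Ext.mk₀_id_comp w, ← Ext.mk₀_id_comp w', ← hid, Ext.mk₀_sum, Ext.sum_comp, Ext.sum_comp]
    refine Finset.sum_congr rfl fun i _ => ?_
    rw [← Ext.mk₀_comp_mk₀_assoc, ← Ext.mk₀_comp_mk₀_assoc]
    exact congrArg (fun e => (Ext.mk₀ (g i)).comp e (zero_add 2)) (LinearMap.congr_fun hw (p i))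
  · intro h
    refine ⟨∑ i, (Ext.mk₀ (g i)).comp (h (p i)) (zero_add 2), LinearMap.ext fun x => ?_⟩
    have hx : x = ∑ i, MulOpposite.op (f i x) • p i := by
      conv_lhs => rw [← LinearMap.id_apply (R := Cᵐᵒᵖ) x, ← hpf, LinearMap.sum_apply]
      rfl
    conv_rhs => rw [hx, _root_.map_sum]
    refine (Ext.comp_sum _ _ (zero_add 2)).trans (Finset.sum_congr rfl fun i _ => ?_)
    rw [h.map_smul, ExtBimodule.op_smul_def, Ext.mk₀_comp_mk₀_assoc]
    rfl

/-- `Ext²(τ M, C)` vanishes if and only if `Hom_C(P₀, E) → Hom_C(P₁, E)` is surjective. -/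
theorem subsingleton_ext_dual_transpose_iff (hC : globalDimension C = 2) {M : Type u}
    [AddCommGroup M] [Module Cᵐᵒᵖ M] (P : MinProjPresentation Cᵐᵒᵖ M) :
    Subsingleton (Ext.{u} (ModuleCat.of Cᵐᵒᵖ (StdDual k (transpose P))) (regularModule C) 2) ↔
      ∀ h : P.P₁ →ₗ[Cᵐᵒᵖ] ExtBimodule k C, ∃ g : P.P₀ →ₗ[Cᵐᵒᵖ] ExtBimodule k C, g ∘ₗ P.d₁ = h := by
  have := P.finite₀
  have := P.finite₁
  have := P.projective₀
  have := P.projective₁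
  have hW : ∀ X : ModuleCat.{u} Cᵐᵒᵖ, Subsingleton (Ext.{u} X (regularModule C) (1 + 2)) :=
    fun X => subsingleton_ext_three hC X _
  let ι : ModuleCat.of Cᵐᵒᵖ (StdDual k (transpose P)) ⟶ nakayama k P.P₁ :=
    ModuleCat.ofHom (StdDual.map k (LinearMap.range (homDual P.d₁)).mkQ)
  have hι : Function.Injective ι.hom := StdDual.map_injective k (Submodule.mkQ_surjective _)
  have hex : Function.Exact ι.hom (nakayamaMap k P.d₁).hom := StdDual.map_exact k _
  constructor
  · intro hs h
    obtain ⟨w, rfl⟩ := (nakayamaExt_bijective k).2 h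
    obtain ⟨z, rfl⟩ := Ext.exists_of_precomp_eq_zero _ hW ι (nakayamaMap k P.d₁) hι hex w
      (Subsingleton.elim _ _)
    exact ⟨nakayamaExt k z, (nakayamaExt_precomp k P.d₁ z).symm⟩
  · intro hs
    refine subsingleton_of_forall_eq 0 fun x => ?_
    obtain ⟨w, rfl⟩ := Ext.precomp_surjective_of_injective _ hW ι hι x
    obtain ⟨g, hg⟩ := hs (nakayamaExt k w)
    obtain ⟨z, rfl⟩ := (nakayamaExt_bijective k).2 g
    rw [← nakayamaExt_precomp, (nakayamaExt_bijective k).1.eq_iff] at hg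
    have hz : ι ≫ nakayamaMap k P.d₁ = 0 :=
      ModuleCat.hom_ext (LinearMap.ext fun y => (hex _).2 ⟨y, rfl⟩)
    rw [← hg, Ext.mk₀_comp_mk₀_assoc, hz, Ext.mk₀_zero, Ext.zero_comp]

end Nakayama

/-! ### The functor `X ↦ Ext²(DC, X)` -/

/-- `Ext²(DC, X)` for a right `C`-module `X`. -/
def ExtDual (k C X : Type u) [Field k] [Ring C] [Algebra k C] [AddCommGroup X] [Module Cᵐᵒᵖ X] :
    Type u :=
  Ext.{u} (dualModule k C) (ModuleCat.of Cᵐᵒᵖ X) 2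

namespace ExtDual

variable {k C X Y Z : Type u} [Field k] [Ring C] [Algebra k C] [AddCommGroup X] [Module Cᵐᵒᵖ X]
  [AddCommGroup Y] [Module Cᵐᵒᵖ Y] [AddCommGroup Z] [Module Cᵐᵒᵖ Z]

instance : AddCommGroup (ExtDual k C X) :=
  inferInstanceAs (AddCommGroup (Ext.{u} (dualModule k C) (ModuleCat.of Cᵐᵒᵖ X) 2))

instance : SMul Cᵐᵒᵖ (ExtDual k C X) :=
  ⟨fun c e => (Ext.mk₀ (dualLeftMul k c.unop)).comp e (zero_add 2)⟩

instance : Module Cᵐᵒᵖ (ExtDual k C X) where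
  one_smul (e : Ext.{u} (dualModule k C) (ModuleCat.of Cᵐᵒᵖ X) 2) := by
    change (Ext.mk₀ (dualLeftMul k (1 : C))).comp e (zero_add 2) = e
    rw [ExtBimodule.dualLeftMul_one, Ext.mk₀_id_comp]
  mul_smul a b (e : Ext.{u} (dualModule k C) (ModuleCat.of Cᵐᵒᵖ X) 2) := by
    change (Ext.mk₀ (dualLeftMul k (b.unop * a.unop))).comp e (zero_add 2) =
      (Ext.mk₀ (dualLeftMul k a.unop)).comp
        ((Ext.mk₀ (dualLeftMul k b.unop)).comp e (zero_add 2)) (zero_add 2)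
    rw [ExtBimodule.dualLeftMul_mul, Ext.mk₀_comp_mk₀_assoc]
  smul_zero a := Ext.comp_zero _ _ _ _ _
  smul_add a e e' := Ext.comp_add _ _ _ _
  add_smul a b (e : Ext.{u} (dualModule k C) (ModuleCat.of Cᵐᵒᵖ X) 2) := by
    change (Ext.mk₀ (dualLeftMul k (a.unop + b.unop))).comp e (zero_add 2) =
      (Ext.mk₀ (dualLeftMul k a.unop)).comp e (zero_add 2) +
        (Ext.mk₀ (dualLeftMul k b.unop)).comp e (zero_add 2)
    rw [ExtBimodule.dualLeftMul_add, Ext.mk₀_add, Ext.add_comp]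
  zero_smul (e : Ext.{u} (dualModule k C) (ModuleCat.of Cᵐᵒᵖ X) 2) := by
    have h : dualLeftMul k (0 : C) = 0 :=
      ModuleCat.hom_ext (LinearMap.ext fun f : StdDual k C => StdDual.ext fun x =>
        (congrArg f (mul_zero x)).trans (_root_.map_zero (show C →ₗ[k] k from f)))
    change (Ext.mk₀ (dualLeftMul k (0 : C))).comp e (zero_add 2) = 0
    rw [h, Ext.mk₀_zero, Ext.zero_comp]

variable (k) in
/-- Functoriality of `Ext²(DC, -)`. -/
def map (f : X →ₗ[Cᵐᵒᵖ] Y) : ExtDual k C X →ₗ[Cᵐᵒᵖ] ExtDual k C Y where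
  toFun e := Ext.comp e (Ext.mk₀ (ModuleCat.ofHom f)) (add_zero 2)
  map_add' _ _ := Ext.add_comp _ _ _ _
  map_smul' _ _ := Ext.comp_assoc_of_third_deg_zero _ _ _ _

theorem map_id (e : ExtDual k C X) : map k LinearMap.id e = e := Ext.comp_mk₀_id e

theorem map_map (g : Y →ₗ[Cᵐᵒᵖ] Z) (f : X →ₗ[Cᵐᵒᵖ] Y) (e : ExtDual k C X) :
    map k g (map k f e) = map k (g ∘ₗ f) e :=
  (Ext.comp_assoc_of_third_deg_zero _ _ _ _).trans
    (congrArg (fun h => Ext.comp e h (add_zero 2))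
      (Ext.mk₀_comp_mk₀ (ModuleCat.ofHom f) (ModuleCat.ofHom g)))

theorem map_add (f g : X →ₗ[Cᵐᵒᵖ] Y) (e : ExtDual k C X) :
    map k (f + g) e = map k f e + map k g e :=
  (congrArg (fun h => Ext.comp e h (add_zero 2))
    (Ext.mk₀_add (ModuleCat.ofHom f) (ModuleCat.ofHom g))).trans (Ext.comp_add _ _ _ _)

theorem map_zero (e : ExtDual k C X) : map k (0 : X →ₗ[Cᵐᵒᵖ] Y) e = 0 :=
  (congrArg (fun h => Ext.comp e h (add_zero 2))
    (Ext.mk₀_zero (ModuleCat.of Cᵐᵒᵖ X) (ModuleCat.of Cᵐᵒᵖ Y))).trans (Ext.comp_zero _ _ _ _ _)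

theorem map_sum {ι : Type} (s : Finset ι) (f : ι → (X →ₗ[Cᵐᵒᵖ] Y)) (e : ExtDual k C X) :
    map k (∑ i ∈ s, f i) e = ∑ i ∈ s, map k (f i) e :=
  _root_.map_sum (⟨⟨fun f => map k f e, map_zero e⟩, fun f g => map_add f g e⟩ :
    (X →ₗ[Cᵐᵒᵖ] Y) →+ ExtDual k C Y) f s

variable (k C) in
/-- `Ext²(DC, C)` as the value of the functor `Ext²(DC, -)` at `C`. -/
def regularEquiv : ExtBimodule k C ≃ₗ[Cᵐᵒᵖ] ExtDual k C C where
  __ := AddEquiv.refl (Ext.{u} (dualModule k C) (regularModule C) 2)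
  map_smul' _ _ := rfl

/-- The image of `e` under `Ext²(DC, C) → Ext²(DC, X)` induced by `c ↦ x c`; it plays the role of
the pure tensor `x ⊗ e`. -/
def tmul (x : X) : ExtBimodule k C →ₗ[Cᵐᵒᵖ] ExtDual k C X :=
  map k (pointMap x) ∘ₗ (regularEquiv k C).toLinearMap

theorem tmul_apply (x : X) (e : ExtBimodule k C) :
    tmul x e = map k (pointMap x) (regularEquiv k C e) := rfl

theorem add_tmul (x y : X) (e : ExtBimodule k C) : tmul (x + y) e = tmul x e + tmul y e := by
  rw [tmul_apply, tmul_apply, tmul_apply, ← map_add]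
  congr 2
  exact LinearMap.ext fun c => smul_add (op c) x y

theorem zero_tmul (e : ExtBimodule k C) : tmul (0 : X) e = 0 := by
  rw [tmul_apply, ← map_zero (regularEquiv k C e)]
  congr 2
  exact LinearMap.ext fun c => smul_zero (op c)

theorem op_smul_tmul (c : Cᵐᵒᵖ) (x : X) (e : ExtBimodule k C) :
    tmul (c • x) e = tmul x (c.unop • e) := by
  have h : pointMap (C := C) (c • x) =
      pointMap x ∘ₗ (show C →ₗ[Cᵐᵒᵖ] C from (leftMul c.unop).hom) :=
    LinearMap.ext fun a => (mul_smul (op a) c x).symm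
  rw [tmul_apply, h, ← map_map]
  rfl

theorem map_tmul (f : X →ₗ[Cᵐᵒᵖ] Y) (x : X) (e : ExtBimodule k C) :
    map k f (tmul x e) = tmul (f x) e := by
  rw [tmul_apply, tmul_apply, map_map]
  congr 2
  exact LinearMap.ext fun c => f.map_smul (op c) x

theorem regularEquiv_symm_tmul (c : C) (e : ExtBimodule k C) :
    (regularEquiv k C).symm (tmul c e) = c • e := rfl

theorem map_surjective (hC : globalDimension C = 2) {f : X →ₗ[Cᵐᵒᵖ] Y}
    (hf : Function.Surjective f) : Function.Surjective (map k f) :=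
  Ext.postcomp_surjective_of_surjective (dualModule k C) (subsingleton_ext_three hC _)
    (ModuleCat.ofHom f) hf

theorem range_map (hC : globalDimension C = 2) {f : X →ₗ[Cᵐᵒᵖ] Y} {g : Y →ₗ[Cᵐᵒᵖ] Z}
    (hg : Function.Surjective g) (hfg : LinearMap.range f = LinearMap.ker g) :
    LinearMap.range (map k f) = LinearMap.ker (map k g) := by
  ext y
  constructor
  · rintro ⟨x, rfl⟩
    have h : g ∘ₗ f = 0 := LinearMap.ext fun x => hfg.le (LinearMap.mem_range_self f x)
    rw [LinearMap.mem_ker, map_map, h, map_zero]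
  · exact Ext.exists_of_postcomp_eq_zero (dualModule k C) (subsingleton_ext_three hC _)
      (ModuleCat.ofHom f) (ModuleCat.ofHom g) hg hfg y

theorem eq_sum_tmul {n : ℕ} {p : Fin n → X} {f : Fin n → (X →ₗ[Cᵐᵒᵖ] C)}
    (h : ∑ i, pointMap (p i) ∘ₗ f i = LinearMap.id) (y : ExtDual k C X) :
    y = ∑ i, tmul (p i) ((regularEquiv k C).symm (map k (f i) y)) := by
  conv_lhs => rw [← map_id y, ← h, map_sum]
  refine Finset.sum_congr rfl fun i _ => ?_
  rw [tmul_apply, LinearEquiv.apply_symm_apply, map_map]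

end ExtDual

/-! ### Modules induced from `C` to the relation extension -/

/-- The right module over the relation extension induced by a right `C`-module `X`; its underlying
group is `X ⊕ Ext²(DC, X)`, which is `X ⊗ B` for finitely generated `X`. -/
def Induced (k C X : Type u) [Field k] [Ring C] [Algebra k C] [AddCommGroup X] [Module Cᵐᵒᵖ X] :
    Type u :=
  X × ExtDual k C X

namespace Induced

variable {k C X Y Z : Type u} [Field k] [Ring C] [Algebra k C] [AddCommGroup X] [Module Cᵐᵒᵖ X]
  [AddCommGroup Y] [Module Cᵐᵒᵖ Y] [AddCommGroup Z] [Module Cᵐᵒᵖ Z]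

instance : AddCommGroup (Induced k C X) := inferInstanceAs (AddCommGroup (X × ExtDual k C X))

variable (k C X) in
/-- The projection `Induced X → X`. -/
def fst : Induced k C X →+ X := AddMonoidHom.fst X (ExtDual k C X)

variable (k C X) in
/-- The projection `Induced X → Ext²(DC, X)`. -/
def snd : Induced k C X →+ ExtDual k C X := AddMonoidHom.snd X (ExtDual k C X)

/-- The element of the induced module with the given components. -/
def mk (x : X) (y : ExtDual k C X) : Induced k C X := (x, y)

variable (k C X) in
/-- The inclusion `X → Induced X`. -/
def inl : X →+ Induced k C X := AddMonoidHom.inl X (ExtDual k C X)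

variable (k C X) in
/-- The inclusion `Ext²(DC, X) → Induced X`. -/
def inr : ExtDual k C X →+ Induced k C X := AddMonoidHom.inr X (ExtDual k C X)

theorem ext {z w : Induced k C X} (h₁ : fst k C X z = fst k C X w)
    (h₂ : snd k C X z = snd k C X w) : z = w := Prod.ext h₁ h₂

theorem fst_mk (x : X) (y : ExtDual k C X) : fst k C X (mk x y) = x := rfl

theorem snd_mk (x : X) (y : ExtDual k C X) : snd k C X (mk x y) = y := rfl

theorem fst_inl (x : X) : fst k C X (inl k C X x) = x := rfl

theorem snd_inl (x : X) : snd k C X (inl k C X x) = 0 := rfl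

theorem fst_inr (y : ExtDual k C X) : fst k C X (inr k C X y) = 0 := rfl

theorem snd_inr (y : ExtDual k C X) : snd k C X (inr k C X y) = y := rfl

instance : SMul (RelExt k C)ᵐᵒᵖ (Induced k C X) :=
  ⟨fun b z => mk (op b.unop.fst • fst k C X z)
    (op b.unop.fst • snd k C X z + ExtDual.tmul (fst k C X z) b.unop.snd)⟩

theorem fst_smul (b : (RelExt k C)ᵐᵒᵖ) (z : Induced k C X) :
    fst k C X (b • z) = op b.unop.fst • fst k C X z := rfl

theorem snd_smul (b : (RelExt k C)ᵐᵒᵖ) (z : Induced k C X) :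
    snd k C X (b • z) =
      op b.unop.fst • snd k C X z + ExtDual.tmul (fst k C X z) b.unop.snd := rfl

instance : Module (RelExt k C)ᵐᵒᵖ (Induced k C X) where
  one_smul z := by
    refine ext ?_ ?_
    · rw [fst_smul, MulOpposite.unop_one, TrivSqZeroExt.fst_one, MulOpposite.op_one, one_smul]
    · rw [snd_smul, MulOpposite.unop_one, TrivSqZeroExt.fst_one, TrivSqZeroExt.snd_one,
        MulOpposite.op_one, one_smul, map_zero, add_zero]
  mul_smul a b z := by
    refine ext ?_ ?_
    · rw [fst_smul, fst_smul, fst_smul, MulOpposite.unop_mul, TrivSqZeroExt.fst_mul,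
        MulOpposite.op_mul, mul_smul]
    · rw [snd_smul, snd_smul, snd_smul, fst_smul, MulOpposite.unop_mul, TrivSqZeroExt.fst_mul,
        TrivSqZeroExt.snd_mul, MulOpposite.op_mul, mul_smul, smul_add, map_add,
        LinearMap.map_smul, ExtDual.op_smul_tmul, MulOpposite.unop_op, add_assoc,
        add_comm (ExtDual.tmul _ _)]
  smul_zero b := by
    refine ext ?_ ?_
    · rw [fst_smul, map_zero, smul_zero]
    · rw [snd_smul, map_zero, map_zero, ExtDual.zero_tmul, smul_zero, add_zero]
  smul_add b z w := by
    refine ext ?_ ?_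
    · rw [fst_smul, map_add, map_add, fst_smul, fst_smul, smul_add]
    · rw [snd_smul, map_add, map_add, map_add, snd_smul, snd_smul, smul_add, ExtDual.add_tmul]
      abel
  add_smul a b z := by
    refine ext ?_ ?_
    · rw [map_add, fst_smul, fst_smul, fst_smul, MulOpposite.unop_add, TrivSqZeroExt.fst_add,
        MulOpposite.op_add, add_smul]
    · rw [map_add, snd_smul, snd_smul, snd_smul, MulOpposite.unop_add, TrivSqZeroExt.fst_add,
        TrivSqZeroExt.snd_add, MulOpposite.op_add, add_smul, map_add]
      abel
  zero_smul z := by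
    refine ext ?_ ?_
    · rw [fst_smul, MulOpposite.unop_zero, TrivSqZeroExt.fst_zero, MulOpposite.op_zero, zero_smul,
        map_zero]
    · rw [snd_smul, MulOpposite.unop_zero, TrivSqZeroExt.fst_zero, TrivSqZeroExt.snd_zero,
        MulOpposite.op_zero, zero_smul, map_zero, add_zero, map_zero]

/-- The map of induced modules with components `f : X → Y` and `g : X → Ext²(DC, Y)`. -/
def hom (f : X →ₗ[Cᵐᵒᵖ] Y) (g : X →ₗ[Cᵐᵒᵖ] ExtDual k C Y) :
    Induced k C X →ₗ[(RelExt k C)ᵐᵒᵖ] Induced k C Y where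
  toFun z := mk (f (fst k C X z)) (ExtDual.map k f (snd k C X z) + g (fst k C X z))
  map_add' z w := by
    refine ext ?_ ?_
    · simp only [map_add, fst_mk]
    · simp only [map_add, snd_mk]
      exact add_add_add_comm _ _ _ _
  map_smul' b z := by
    refine ext ?_ ?_
    · simp only [RingHom.id_apply, fst_smul, fst_mk, map_smul]
    · simp only [RingHom.id_apply, fst_smul, snd_smul, fst_mk, snd_mk, map_add, map_smul,
        ExtDual.map_tmul, smul_add]
      exact add_right_comm _ _ _

theorem fst_hom (f : X →ₗ[Cᵐᵒᵖ] Y) (g : X →ₗ[Cᵐᵒᵖ] ExtDual k C Y) (z : Induced k C X) :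
    fst k C Y (hom f g z) = f (fst k C X z) := rfl

theorem snd_hom (f : X →ₗ[Cᵐᵒᵖ] Y) (g : X →ₗ[Cᵐᵒᵖ] ExtDual k C Y) (z : Induced k C X) :
    snd k C Y (hom f g z) = ExtDual.map k f (snd k C X z) + g (fst k C X z) := rfl

variable (k C) in
/-- The module induced by `C` is the relation extension. -/
def regularEquiv : Induced k C C ≃ₗ[(RelExt k C)ᵐᵒᵖ] RelExt k C where
  toFun z := (fst k C C z, (ExtDual.regularEquiv k C).symm (snd k C C z))
  invFun b := mk b.fst (ExtDual.regularEquiv k C b.snd)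
  left_inv _ := rfl
  right_inv _ := rfl
  map_add' _ _ := rfl
  map_smul' b z := by
    refine TrivSqZeroExt.ext rfl ?_
    change (ExtDual.regularEquiv k C).symm (snd k C C (b • z)) =
      fst k C C z • b.unop.snd + op b.unop.fst • (ExtDual.regularEquiv k C).symm (snd k C C z)
    rw [snd_smul, map_add, map_smul, ExtDual.regularEquiv_symm_tmul, add_comm]

/-- The map `Induced X → B` with components `a : X → C` and `b : X → Ext²(DC, C)`. -/
def toRing (a : X →ₗ[Cᵐᵒᵖ] C) (b : X →ₗ[Cᵐᵒᵖ] ExtBimodule k C) :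
    Induced k C X →ₗ[(RelExt k C)ᵐᵒᵖ] RelExt k C :=
  (regularEquiv k C).toLinearMap ∘ₗ hom a ((ExtDual.regularEquiv k C).toLinearMap ∘ₗ b)

theorem fst_toRing (a : X →ₗ[Cᵐᵒᵖ] C) (b : X →ₗ[Cᵐᵒᵖ] ExtBimodule k C) (z : Induced k C X) :
    (toRing a b z).fst = a (fst k C X z) := rfl

theorem snd_toRing (a : X →ₗ[Cᵐᵒᵖ] C) (b : X →ₗ[Cᵐᵒᵖ] ExtBimodule k C) (z : Induced k C X) :
    (toRing a b z).snd =
      (ExtDual.regularEquiv k C).symm (ExtDual.map k a (snd k C X z)) + b (fst k C X z) := rfl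

theorem op_inr_smul (e : ExtBimodule k C) (z : Induced k C X) :
    (op (TrivSqZeroExt.inr e) : (RelExt k C)ᵐᵒᵖ) • z =
      inr k C X (ExtDual.tmul (fst k C X z) e) := by
  refine ext ?_ ?_
  · rw [fst_smul, MulOpposite.unop_op, TrivSqZeroExt.fst_inr, MulOpposite.op_zero, zero_smul,
      fst_inr]
  · rw [snd_smul, MulOpposite.unop_op, TrivSqZeroExt.fst_inr, TrivSqZeroExt.snd_inr,
      MulOpposite.op_zero, zero_smul, zero_add, snd_inr]

theorem op_inl_smul (c : Cᵐᵒᵖ) (x : X) :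
    (op (TrivSqZeroExt.inl c.unop) : (RelExt k C)ᵐᵒᵖ) • inl k C X x = inl k C X (c • x) := by
  refine ext ?_ ?_
  · rw [fst_smul, MulOpposite.unop_op, TrivSqZeroExt.fst_inl, MulOpposite.op_unop, fst_inl, fst_inl]
  · rw [snd_smul, MulOpposite.unop_op, TrivSqZeroExt.fst_inl, TrivSqZeroExt.snd_inl, snd_inl,
      snd_inl, smul_zero, map_zero, add_zero]

theorem apply_inl_smul (φ : Induced k C X →ₗ[(RelExt k C)ᵐᵒᵖ] RelExt k C) (c : Cᵐᵒᵖ) (x : X) :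
    φ (inl k C X (c • x)) = φ (inl k C X x) * TrivSqZeroExt.inl c.unop := by
  rw [← op_inl_smul, map_smul]
  rfl

/-- The component `X → C` of a map `Induced X → B`. -/
def fstComp (φ : Induced k C X →ₗ[(RelExt k C)ᵐᵒᵖ] RelExt k C) : X →ₗ[Cᵐᵒᵖ] C where
  toFun x := (φ (inl k C X x)).fst
  map_add' x y := by rw [map_add, map_add, TrivSqZeroExt.fst_add]
  map_smul' c x := by
    rw [apply_inl_smul, TrivSqZeroExt.fst_mul, TrivSqZeroExt.fst_inl]
    rfl

/-- The component `X → Ext²(DC, C)` of a map `Induced X → B`. -/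
def sndComp (φ : Induced k C X →ₗ[(RelExt k C)ᵐᵒᵖ] RelExt k C) : X →ₗ[Cᵐᵒᵖ] ExtBimodule k C where
  toFun x := (φ (inl k C X x)).snd
  map_add' x y := by rw [map_add, map_add, TrivSqZeroExt.snd_add]
  map_smul' c x := by
    rw [apply_inl_smul, TrivSqZeroExt.snd_mul, TrivSqZeroExt.snd_inl, TrivSqZeroExt.fst_inl,
      smul_zero, zero_add, MulOpposite.op_unop]
    rfl

theorem fstComp_apply (φ : Induced k C X →ₗ[(RelExt k C)ᵐᵒᵖ] RelExt k C) (x : X) :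
    fstComp φ x = (φ (inl k C X x)).fst := rfl

theorem sndComp_apply (φ : Induced k C X →ₗ[(RelExt k C)ᵐᵒᵖ] RelExt k C) (x : X) :
    sndComp φ x = (φ (inl k C X x)).snd := rfl

theorem hom_inl (f : X →ₗ[Cᵐᵒᵖ] Y) (g : X →ₗ[Cᵐᵒᵖ] ExtDual k C Y) (x : X) :
    hom f g (inl k C X x) = inl k C Y (f x) + inr k C Y (g x) := by
  refine ext ?_ ?_
  · rw [fst_hom, fst_inl, map_add, fst_inl, fst_inr, add_zero]
  · rw [snd_hom, fst_inl, snd_inl, map_zero, map_add, snd_inl, snd_inr]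

theorem toRing_inr (a : X →ₗ[Cᵐᵒᵖ] C) (b : X →ₗ[Cᵐᵒᵖ] ExtBimodule k C) (y : ExtDual k C X) :
    toRing a b (inr k C X y) =
      TrivSqZeroExt.inr ((ExtDual.regularEquiv k C).symm (ExtDual.map k a y)) := by
  refine TrivSqZeroExt.ext ?_ ?_
  · rw [fst_toRing, fst_inr, map_zero, TrivSqZeroExt.fst_inr]
  · rw [snd_toRing, snd_inr, fst_inr, map_zero, add_zero, TrivSqZeroExt.snd_inr]

theorem toRing_inl (a : X →ₗ[Cᵐᵒᵖ] C) (b : X →ₗ[Cᵐᵒᵖ] ExtBimodule k C) (x : X) :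
    toRing a b (inl k C X x) = TrivSqZeroExt.inl (a x) + TrivSqZeroExt.inr (b x) := by
  refine TrivSqZeroExt.ext ?_ ?_
  · rw [fst_toRing, fst_inl, TrivSqZeroExt.fst_add, TrivSqZeroExt.fst_inl, TrivSqZeroExt.fst_inr,
      add_zero]
  · rw [snd_toRing, snd_inl, fst_inl, map_zero, map_zero, TrivSqZeroExt.snd_add,
      TrivSqZeroExt.snd_inl, TrivSqZeroExt.snd_inr]

section Projective

variable [Module.Finite Cᵐᵒᵖ X] [Module.Projective Cᵐᵒᵖ X]

/-- A submodule that surjects onto `X` is everything, if `X` is finitely generated projective. -/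
theorem eq_top_of_fst_surjective (N : Submodule (RelExt k C)ᵐᵒᵖ (Induced k C X))
    (hN : ∀ x : X, ∃ z ∈ N, fst k C X z = x) : N = ⊤ := by
  obtain ⟨n, p, f, hpf⟩ := exists_dualBasis C X
  have hinr : ∀ y : ExtDual k C X, inr k C X y ∈ N := by
    intro y
    rw [ExtDual.eq_sum_tmul hpf y, map_sum]
    refine Submodule.sum_mem _ fun i _ => ?_
    obtain ⟨z, hz, hzp⟩ := hN (p i)
    rw [← hzp]
    rw [← op_inr_smul]
    exact N.smul_mem _ hz
  refine eq_top_iff.2 fun w _ => ?_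
  obtain ⟨z, hz, hzw⟩ := hN (fst k C X w)
  have : w = z + inr k C X (snd k C X w - snd k C X z) :=
    ext (by rw [map_add, hzw, fst_inr, add_zero]) (by rw [map_add, snd_inr, add_sub_cancel])
  rw [this]
  exact N.add_mem hz (hinr _)

/-- Maps out of an induced module are determined by their restriction to `X`. -/
theorem hom_ext {W : Type u} [AddCommGroup W] [Module (RelExt k C)ᵐᵒᵖ W]
    {φ ψ : Induced k C X →ₗ[(RelExt k C)ᵐᵒᵖ] W} (h : ∀ x, φ (inl k C X x) = ψ (inl k C X x)) :
    φ = ψ := by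
  have := eq_top_of_fst_surjective (LinearMap.eqLocus φ ψ) fun x => ⟨inl k C X x, h x, rfl⟩
  exact LinearMap.ext fun z => LinearMap.mem_eqLocus.1 (this ▸ Submodule.mem_top)

theorem eq_toRing (φ : Induced k C X →ₗ[(RelExt k C)ᵐᵒᵖ] RelExt k C) :
    φ = toRing (fstComp φ) (sndComp φ) :=
  hom_ext fun x => by
    rw [toRing_inl, fstComp_apply, sndComp_apply, TrivSqZeroExt.inl_fst_add_inr_snd_eq]

theorem isSuperfluous {L : Submodule (RelExt k C)ᵐᵒᵖ (Induced k C X)} {K : Submodule Cᵐᵒᵖ X}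
    (hK : IsSuperfluous K) (hL : ∀ z ∈ L, fst k C X z ∈ K) : IsSuperfluous L := by
  intro N hN
  let N' : Submodule Cᵐᵒᵖ X :=
    { carrier := {x | ∃ z ∈ N, fst k C X z = x}
      add_mem' := by
        rintro _ _ ⟨z, hz, rfl⟩ ⟨w, hw, rfl⟩
        exact ⟨z + w, N.add_mem hz hw, map_add _ _ _⟩
      zero_mem' := ⟨0, N.zero_mem, map_zero _⟩
      smul_mem' := by
        rintro c _ ⟨z, hz, rfl⟩
        exact ⟨op (TrivSqZeroExt.inl c.unop) • z, N.smul_mem _ hz, rfl⟩ }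
  have h : N' = ⊤ := by
    refine hK N' (eq_top_iff.2 fun x _ => ?_)
    obtain ⟨z, hz, w, hw, hzw⟩ := Submodule.mem_sup.1 (hN ▸ Submodule.mem_top (x := inl k C X x))
    refine Submodule.mem_sup.2 ⟨fst k C X z, ⟨z, hz, rfl⟩, fst k C X w, hL w hw, ?_⟩
    rw [← map_add, hzw, fst_inl]
  exact eq_top_of_fst_surjective N fun x => h.ge (Submodule.mem_top (x := x))

theorem finite_and_projective : Module.Finite (RelExt k C)ᵐᵒᵖ (Induced k C X) ∧
    Module.Projective (RelExt k C)ᵐᵒᵖ (Induced k C X) := by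
  obtain ⟨n, p, f, hpf⟩ := exists_dualBasis C X
  let u : RelExt k C ≃ₗ[(RelExt k C)ᵐᵒᵖ] (RelExt k C)ᵐᵒᵖ :=
    { toFun := op
      invFun := MulOpposite.unop
      left_inv := fun _ => rfl
      right_inv := fun _ => rfl
      map_add' := fun _ _ => rfl
      map_smul' := fun _ _ => rfl }
  let s : (Fin n → (RelExt k C)ᵐᵒᵖ) →ₗ[(RelExt k C)ᵐᵒᵖ] Induced k C X :=
    ∑ i, LinearMap.toSpanSingleton _ _ (inl k C X (p i)) ∘ₗ LinearMap.proj i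
  let t : Induced k C X →ₗ[(RelExt k C)ᵐᵒᵖ] (Fin n → (RelExt k C)ᵐᵒᵖ) :=
    LinearMap.pi fun i => u.toLinearMap ∘ₗ toRing (f i) 0
  have hst : s ∘ₗ t = LinearMap.id := by
    refine hom_ext fun x => ?_
    have hx : x = ∑ i, op (f i x) • p i := by
      conv_lhs => rw [← LinearMap.id_apply (R := Cᵐᵒᵖ) x, ← hpf, LinearMap.sum_apply]
      rfl
    conv_rhs => rw [LinearMap.id_apply, hx, map_sum]
    refine (LinearMap.sum_apply _ _ _).trans (Finset.sum_congr rfl fun i _ => ?_)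
    change (op (toRing (f i) 0 (inl k C X x)) : (RelExt k C)ᵐᵒᵖ) • inl k C X (p i) = _
    rw [toRing_inl, LinearMap.zero_apply, TrivSqZeroExt.inr_zero, add_zero]
    exact op_inl_smul (op (f i x)) (p i)
  exact ⟨Module.Finite.of_surjective s
    (LinearMap.surjective_of_comp_eq_id _ _ hst), Module.Projective.of_split t s hst⟩

end Projective

end Induced

/-! ### A minimal projective presentation over the relation extension -/

theorem finite_hom (k C P : Type u) [Field k] [Ring C] [Algebra k C] [Module.Finite k C]
    [AddCommGroup P] [Module Cᵐᵒᵖ P] [Module.Finite Cᵐᵒᵖ P] :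
    Module.Finite k (P →ₗ[Cᵐᵒᵖ] C) := by
  obtain ⟨n, s, hs⟩ := Module.Finite.exists_fin' Cᵐᵒᵖ P
  let φ : (P →ₗ[Cᵐᵒᵖ] C) →ₗ[k] (Fin n → C) :=
    { toFun := fun f i => f (s (Pi.single i 1))
      map_add' := fun _ _ => rfl
      map_smul' := fun _ _ => rfl }
  refine Module.Finite.of_injective φ fun f g hfg => ?_
  have h : f ∘ₗ s = g ∘ₗ s := (Pi.basisFun Cᵐᵒᵖ (Fin n)).ext fun i => by
    rw [Pi.basisFun_apply]
    exact congrFun hfg i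
  refine LinearMap.ext fun x => ?_
  obtain ⟨y, rfl⟩ := hs x
  exact LinearMap.congr_fun h y

instance finite_transpose (k C M : Type u) [Field k] [Ring C] [Algebra k C] [Module.Finite k C]
    [AddCommGroup M] [Module Cᵐᵒᵖ M] (P : MinProjPresentation Cᵐᵒᵖ M) :
    Module.Finite k (transpose P) := by
  have := P.finite₁
  have := finite_hom k C P.P₁
  exact Module.Finite.quotient k (LinearMap.range (homDual P.d₁))

instance finite_stdDual (k X : Type u) [Field k] [AddCommGroup X] [Module k X] [Module.Finite k X] :
    Module.Finite k (StdDual k X) :=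
  inferInstanceAs (Module.Finite k (X →ₗ[k] k))

theorem ExtDual.finite (k C P : Type u) [Field k] [Ring C] [Algebra k C] [Module.Finite k C]
    [AddCommGroup P] [Module Cᵐᵒᵖ P] [Module.Finite Cᵐᵒᵖ P] [Module.Projective Cᵐᵒᵖ P] :
    Module.Finite Cᵐᵒᵖ (ExtDual k C P) := by
  obtain ⟨n, p, f, hpf⟩ := exists_dualBasis C P
  have : Module.Finite Cᵐᵒᵖ (ExtBimodule k C) := Module.Finite.of_restrictScalars_finite k _ _
  let s : (Fin n → ExtBimodule k C) →ₗ[Cᵐᵒᵖ] ExtDual k C P :=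
    ∑ i, ExtDual.tmul (p i) ∘ₗ LinearMap.proj i
  refine Module.Finite.of_surjective s fun y =>
    ⟨fun i => (ExtDual.regularEquiv k C).symm (ExtDual.map k (f i) y), ?_⟩
  conv_rhs => rw [ExtDual.eq_sum_tmul hpf y]
  exact LinearMap.sum_apply _ _ _

section Presentation

variable {k C : Type u} [Field k] [Ring C] [Algebra k C] {M : ModuleCat.{u} Cᵐᵒᵖ}
  (P : MinProjPresentation Cᵐᵒᵖ M) {Q : Type u} [AddCommGroup Q] [Module Cᵐᵒᵖ Q]
  (q : Q →ₗ[Cᵐᵒᵖ] ExtDual k C P.P₀)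

/-- The augmentation `Induced P₀ → M`. -/
def inducedAugmentation :
    Induced k C P.P₀ →ₗ[(RelExt k C)ᵐᵒᵖ] ((toRelExt k C).obj M : ModuleCat.{u} _) where
  toFun z := P.d₀ (Induced.fst k C P.P₀ z)
  map_add' z w := (congrArg P.d₀ (map_add (Induced.fst k C P.P₀) z w)).trans (map_add P.d₀ _ _)
  map_smul' b _ := P.d₀.map_smul (op b.unop.fst) _

theorem inducedAugmentation_apply (z : Induced k C P.P₀) :
    inducedAugmentation P z = P.d₀ (Induced.fst k C P.P₀ z) := rfl

/-- The differential `Induced (P₁ × Q) → Induced P₀`. -/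
def inducedDifferential :
    Induced k C (P.P₁ × Q) →ₗ[(RelExt k C)ᵐᵒᵖ] Induced k C P.P₀ :=
  Induced.hom (P.d₁ ∘ₗ LinearMap.fst Cᵐᵒᵖ P.P₁ Q) (q ∘ₗ LinearMap.snd Cᵐᵒᵖ P.P₁ Q)

theorem inducedDifferential_inl (x : P.P₁ × Q) :
    inducedDifferential P q (Induced.inl k C _ x) =
      Induced.inl k C _ (P.d₁ x.1) + Induced.inr k C _ (q x.2) :=
  Induced.hom_inl _ _ _

variable [Module.Finite Cᵐᵒᵖ Q] [Module.Projective Cᵐᵒᵖ Q]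

/-- The minimal projective presentation of `M` over the relation extension built from a minimal
projective presentation `P₁ → P₀ → M` over `C` and a projective cover `Q` of `Ext²(DC, M)`. -/
def inducedPresentation (hC : globalDimension C = 2)
    (hq : Function.Surjective (ExtDual.map k P.d₀ ∘ₗ q))
    (hq' : IsSuperfluous (LinearMap.ker (ExtDual.map k P.d₀ ∘ₗ q))) :
    MinProjPresentation (RelExt k C)ᵐᵒᵖ ((toRelExt k C).obj M) :=
  have := P.finite₀
  have := P.finite₁
  have := P.projective₀
  have := P.projective₁
  have hzero : ∀ y, ExtDual.map k P.d₀ (ExtDual.map k P.d₁ y) = 0 := fun y =>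
    (ExtDual.range_map hC P.surjective P.exact).le (LinearMap.mem_range_self _ y)
  { P₁ := Induced k C (P.P₁ × Q)
    P₀ := Induced k C P.P₀
    finite₁ := Induced.finite_and_projective.1
    finite₀ := Induced.finite_and_projective.1
    projective₁ := Induced.finite_and_projective.2
    projective₀ := Induced.finite_and_projective.2
    d₁ := inducedDifferential P q
    d₀ := inducedAugmentation P
    surjective := fun m => by
      obtain ⟨x, rfl⟩ := P.surjective m
      exact ⟨Induced.inl k C _ x, rfl⟩
    exact := by
      ext z
      rw [LinearMap.mem_ker, inducedAugmentation_apply]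
      constructor
      · rintro ⟨w, rfl⟩
        exact P.exact.le (LinearMap.mem_range_self P.d₁ _)
      · intro hz
        obtain ⟨x, hx⟩ := P.exact.ge hz
        obtain ⟨v, hv⟩ := hq (ExtDual.map k P.d₀ (Induced.snd k C _ z))
        obtain ⟨y, hy⟩ := (ExtDual.range_map hC P.surjective P.exact).ge
          (show Induced.snd k C _ z - q v ∈ _ by
            rw [LinearMap.mem_ker, map_sub, ← hv, LinearMap.comp_apply, sub_self])
        refine ⟨Induced.mk (x, v) (ExtDual.map k (LinearMap.inl Cᵐᵒᵖ P.P₁ Q) y), ?_⟩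
        refine Induced.ext hx ?_
        change ExtDual.map k _ (ExtDual.map k _ y) + q v = _
        rw [ExtDual.map_map, LinearMap.comp_assoc, LinearMap.fst_comp_inl, LinearMap.comp_id, hy,
          sub_add_cancel]
    minimal₀ := Induced.isSuperfluous P.minimal₀ fun _ => id
    minimal₁ := by
      refine Induced.isSuperfluous (P.minimal₁.prod hq') fun z hz => ?_
      refine ⟨congrArg (Induced.fst k C _) hz, ?_⟩
      have h := congrArg (fun w => ExtDual.map k P.d₀ (Induced.snd k C _ w)) hz
      change ExtDual.map k P.d₀ (ExtDual.map k (P.d₁ ∘ₗ LinearMap.fst Cᵐᵒᵖ P.P₁ Q)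
        (Induced.snd k C _ z) + q (Induced.fst k C _ z).2) = ExtDual.map k P.d₀ 0 at h
      rw [map_add, ← ExtDual.map_map, hzero, zero_add, map_zero] at h
      exact h }

end Presentation

/-! ### Comparison of the transposes -/

section Comparison

variable {k C : Type u} [Field k] [Ring C] [Algebra k C]

/-- The projection of the relation extension onto `C`. -/
abbrev relExtFst (k C : Type u) [Field k] [Ring C] [Algebra k C] : RelExt k C →+* C :=
  (TrivSqZeroExt.fstHom k C (ExtBimodule k C)).toRingHom

/-- The component map `Hom_B(Induced X, B) → Hom_C(X, C)`. -/
def baseComponent (k C X : Type u) [Field k] [Ring C] [Algebra k C] [AddCommGroup X]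
    [Module Cᵐᵒᵖ X] :
    (Induced k C X →ₗ[(RelExt k C)ᵐᵒᵖ] RelExt k C) →ₛₗ[relExtFst k C] (X →ₗ[Cᵐᵒᵖ] C) where
  toFun := Induced.fstComp
  map_add' _ _ := rfl
  map_smul' _ _ := rfl

variable {M : ModuleCat.{u} Cᵐᵒᵖ}
  (P : MinProjPresentation Cᵐᵒᵖ M) {Q : Type u} [AddCommGroup Q] [Module Cᵐᵒᵖ Q]
  (q : Q →ₗ[Cᵐᵒᵖ] ExtDual k C P.P₀)

theorem toRing_inducedDifferential_inl (a : P.P₀ →ₗ[Cᵐᵒᵖ] C) (b : P.P₀ →ₗ[Cᵐᵒᵖ] ExtBimodule k C)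
    (x : P.P₁ × Q) :
    Induced.toRing a b (inducedDifferential P q (Induced.inl k C _ x)) =
      TrivSqZeroExt.inl (a (P.d₁ x.1)) + TrivSqZeroExt.inr (b (P.d₁ x.1)) +
        TrivSqZeroExt.inr ((ExtDual.regularEquiv k C).symm (ExtDual.map k a (q x.2))) := by
  rw [inducedDifferential_inl, map_add, Induced.toRing_inl, Induced.toRing_inr]

variable [Module.Finite Cᵐᵒᵖ Q] [Module.Projective Cᵐᵒᵖ Q] (hC : globalDimension C = 2)
  (hq : Function.Surjective (ExtDual.map k P.d₀ ∘ₗ q))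
  (hq' : IsSuperfluous (LinearMap.ker (ExtDual.map k P.d₀ ∘ₗ q)))

/-- The comparison map from the transpose over the relation extension to the transpose over `C`. -/
def transposeComparison :
    transpose (inducedPresentation P q hC hq hq') →ₛₗ[relExtFst k C] transpose P :=
  Submodule.liftQ _ ((LinearMap.range (homDual P.d₁)).mkQ ∘ₛₗ
    (homDual (LinearMap.inl Cᵐᵒᵖ P.P₁ Q)) ∘ₛₗ baseComponent k C (P.P₁ × Q)) (by
      have := P.finite₀
      have := P.projective₀
      rintro _ ⟨ψ, rfl⟩
      refine (Submodule.Quotient.mk_eq_zero _).2 ⟨Induced.fstComp (X := P.P₀) ψ, ?_⟩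
      refine LinearMap.ext fun x => ?_
      change (ψ (Induced.inl k C _ (P.d₁ x))).fst =
        (ψ (inducedDifferential P q (Induced.inl k C _ (x, 0)))).fst
      rw [inducedDifferential_inl, map_zero, map_zero, add_zero])

theorem transposeComparison_surjective :
    Function.Surjective (transposeComparison P q hC hq hq') := by
  intro t
  obtain ⟨a, rfl⟩ := Submodule.mkQ_surjective _ t
  exact ⟨Submodule.Quotient.mk (Induced.toRing (a ∘ₗ LinearMap.fst Cᵐᵒᵖ P.P₁ Q) 0), rfl⟩

theorem transposeComparison_mk_eq_zero_iff
    (φ : Induced k C (P.P₁ × Q) →ₗ[(RelExt k C)ᵐᵒᵖ] RelExt k C) :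
    transposeComparison P q hC hq hq' (Submodule.Quotient.mk φ) = 0 ↔
      ∃ a : P.P₀ →ₗ[Cᵐᵒᵖ] C, ∀ x : P.P₁, a (P.d₁ x) = Induced.fstComp φ (x, 0) := by
  refine (Submodule.Quotient.mk_eq_zero _).trans (exists_congr fun a => ?_)
  exact LinearMap.ext_iff

theorem transpose_mk_eq_zero_iff
    (φ : Induced k C (P.P₁ × Q) →ₗ[(RelExt k C)ᵐᵒᵖ] RelExt k C) :
    (Submodule.Quotient.mk φ : transpose (inducedPresentation P q hC hq hq')) = 0 ↔
      ∃ (a : P.P₀ →ₗ[Cᵐᵒᵖ] C) (b : P.P₀ →ₗ[Cᵐᵒᵖ] ExtBimodule k C), ∀ x : P.P₁ × Q,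
        TrivSqZeroExt.inl (a (P.d₁ x.1)) + TrivSqZeroExt.inr (b (P.d₁ x.1)) +
          TrivSqZeroExt.inr ((ExtDual.regularEquiv k C).symm (ExtDual.map k a (q x.2))) =
            φ (Induced.inl k C _ x) := by
  have := P.finite₀
  have := P.finite₁
  have := P.projective₀
  have := P.projective₁
  refine (Submodule.Quotient.mk_eq_zero _).trans ⟨?_, ?_⟩
  · rintro ⟨ψ, rfl⟩
    refine ⟨Induced.fstComp (X := P.P₀) ψ, Induced.sndComp (X := P.P₀) ψ, fun x => ?_⟩
    rw [← toRing_inducedDifferential_inl]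
    exact LinearMap.congr_fun (Induced.eq_toRing (X := P.P₀) ψ).symm _
  · rintro ⟨a, b, h⟩
    refine ⟨Induced.toRing a b, Induced.hom_ext fun x => ?_⟩
    rw [← h, ← toRing_inducedDifferential_inl]
    rfl

theorem transposeComparison_injective_iff :
    Function.Injective (transposeComparison P q hC hq hq') ↔
      Subsingleton (ExtDual k C M) ∧
        ∀ h : P.P₁ →ₗ[Cᵐᵒᵖ] ExtBimodule k C, ∃ g : P.P₀ →ₗ[Cᵐᵒᵖ] ExtBimodule k C,
          g ∘ₗ P.d₁ = h := by
  rw [injective_iff_map_eq_zero]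
  constructor
  · intro hinj
    constructor
    · have hQ : ∀ g : Q →ₗ[Cᵐᵒᵖ] C, g = 0 := by
        intro g
        obtain ⟨a, b, h⟩ := (transpose_mk_eq_zero_iff P q hC hq hq'
          (Induced.toRing (g ∘ₗ LinearMap.snd Cᵐᵒᵖ P.P₁ Q) 0)).1 (hinj _
            ((transposeComparison_mk_eq_zero_iff P q hC hq hq' _).2
              ⟨0, fun x => (map_zero g).symm⟩))
        refine LinearMap.ext fun y => ?_
        have h' := congrArg TrivSqZeroExt.fst (h (0, y))
        rw [Induced.fst_toRing, Induced.fst_inl, TrivSqZeroExt.fst_add, TrivSqZeroExt.fst_add,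
          TrivSqZeroExt.fst_inl, TrivSqZeroExt.fst_inr, TrivSqZeroExt.fst_inr, map_zero, map_zero,
          add_zero, add_zero] at h'
        exact h'.symm
      obtain ⟨n, p, f, hpf⟩ := exists_dualBasis C Q
      have hid : ∀ y : Q, y = 0 := fun y => by
        conv_lhs => rw [← LinearMap.id_apply (R := Cᵐᵒᵖ) y, ← hpf, LinearMap.sum_apply]
        refine Finset.sum_eq_zero fun i _ => ?_
        rw [hQ (f i), LinearMap.comp_zero, LinearMap.zero_apply]
      refine subsingleton_of_forall_eq 0 fun t => ?_
      obtain ⟨y, rfl⟩ := hq t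
      rw [hid y, map_zero]
    · intro g
      obtain ⟨a, b, h⟩ := (transpose_mk_eq_zero_iff P q hC hq hq'
        (Induced.toRing 0 (g ∘ₗ LinearMap.fst Cᵐᵒᵖ P.P₁ Q))).1 (hinj _
          ((transposeComparison_mk_eq_zero_iff P q hC hq hq' _).2 ⟨0, fun x => rfl⟩))
      refine ⟨b, LinearMap.ext fun x => ?_⟩
      have h' := congrArg TrivSqZeroExt.snd (h (x, 0))
      rw [Induced.toRing_inl, TrivSqZeroExt.snd_add, TrivSqZeroExt.snd_add, TrivSqZeroExt.snd_add,
        TrivSqZeroExt.snd_inl, TrivSqZeroExt.snd_inl, TrivSqZeroExt.snd_inr, TrivSqZeroExt.snd_inr,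
        TrivSqZeroExt.snd_inr, map_zero, map_zero, map_zero, add_zero, zero_add, zero_add] at h'
      exact h'
  · rintro ⟨hM, hE⟩ t ht
    obtain ⟨φ, rfl⟩ : ∃ φ : Induced k C (P.P₁ × Q) →ₗ[(RelExt k C)ᵐᵒᵖ] RelExt k C,
      Submodule.Quotient.mk φ = t := Submodule.Quotient.mk_surjective _ t
    obtain ⟨a, ha⟩ := (transposeComparison_mk_eq_zero_iff P q hC hq hq' φ).1 ht
    obtain ⟨b, hb⟩ := hE (Induced.sndComp (X := P.P₁ × Q) φ ∘ₗ LinearMap.inl Cᵐᵒᵖ P.P₁ Q)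
    have hQ : ∀ y : Q, y = 0 := fun y => by
      have h := hq' ⊥ (by
        rw [bot_sup_eq]
        exact eq_top_iff.2 fun y _ => Subsingleton.elim _ _)
      exact h.ge (Submodule.mem_top (x := y))
    refine (transpose_mk_eq_zero_iff P q hC hq hq' φ).2 ⟨a, b, fun x => ?_⟩
    obtain ⟨x, y⟩ := x
    have h₁ : b (P.d₁ x) = Induced.sndComp (X := P.P₁ × Q) φ (x, 0) := LinearMap.congr_fun hb x
    rw [hQ y, map_zero, map_zero, map_zero, TrivSqZeroExt.inr_zero, add_zero, ha, h₁,
      Induced.fstComp_apply, Induced.sndComp_apply]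
    exact TrivSqZeroExt.inl_fst_add_inr_snd_eq _

end Comparison

/-- A surjective map `U → V` from a `B`-module to a `C`-module is injective if and only if the duals
`D V` and `D U` are isomorphic. -/
theorem nonempty_iso_stdDual_iff {k C U V : Type u} [Field k] [Ring C] [Algebra k C]
    [AddCommGroup U] [Module k U] [Module (RelExt k C) U] [IsScalarTower k (RelExt k C) U]
    [AddCommGroup V] [Module k V] [Module C V] [IsScalarTower k C V] [Module.Finite k U]
    [Module.Finite k V] (T : U →ₛₗ[relExtFst k C] V) (hT : Function.Surjective T) :
    Nonempty ((toRelExt k C).obj (ModuleCat.of Cᵐᵒᵖ (StdDual k V)) ≅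
        ModuleCat.of (RelExt k C)ᵐᵒᵖ (StdDual k U)) ↔ Function.Injective T := by
  have hsmul : ∀ (r : k) (u : U), T (r • u) = r • T u := by
    intro r u
    rw [← algebraMap_smul (RelExt k C) r u, T.map_smulₛₗ, ← algebraMap_smul C r (T u)]
    rfl
  let T' : U →ₗ[k] V := { toFun := T, map_add' := map_add T, map_smul' := hsmul }
  constructor
  · rintro ⟨e⟩
    let e' := e.toLinearEquiv
    let f : (V →ₗ[k] k) ≃ₗ[k] (U →ₗ[k] k) :=
      { toFun := fun g => e' g
        invFun := fun g => e'.symm g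
        left_inv := e'.left_inv
        right_inv := e'.right_inv
        map_add' := map_add e'
        map_smul' := fun r g => by
          have h₁ : r • g = ((op (algebraMap k (RelExt k C) r) •
              (show ((toRelExt k C).obj (ModuleCat.of Cᵐᵒᵖ (StdDual k V)) : ModuleCat.{u} _)
                from g) :) : StdDual k V) :=
            StdDual.ext fun v =>
              (map_smul g r v).symm.trans (congrArg g (algebraMap_smul C r v).symm)
          have h₂ : ∀ h : StdDual k U, op (algebraMap k (RelExt k C) r) • h = r • h := fun h =>
            StdDual.ext fun v => (congrArg h (algebraMap_smul (RelExt k C) r v)).trans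
              (LinearMap.map_smul (show U →ₗ[k] k from h) r v)
          exact (congrArg e' h₁).trans ((e'.map_smul _ _).trans (h₂ _)) }
    have hfin := f.finrank_eq
    rw [Subspace.dual_finrank_eq, Subspace.dual_finrank_eq] at hfin
    exact (LinearMap.injective_iff_surjective_of_finrank_eq_finrank (f := T') hfin.symm).2 hT
  · intro hinj
    let f : ((toRelExt k C).obj (ModuleCat.of Cᵐᵒᵖ (StdDual k V)) : ModuleCat.{u} _)
        →ₗ[(RelExt k C)ᵐᵒᵖ] StdDual k U :=
      { toFun := fun g => LinearMap.comp (show V →ₗ[k] k from g) T'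
        map_add' := fun _ _ => rfl
        map_smul' := fun b g => StdDual.ext fun u =>
          congrArg (show StdDual k V from g) (T.map_smulₛₗ b.unop u).symm }
    have hf : Function.Bijective f := by
      let T'' := LinearEquiv.ofBijective T' ⟨hinj, hT⟩
      constructor
      · intro g h hgh
        refine StdDual.ext (X := V) fun v => ?_
        obtain ⟨u, rfl⟩ := hT v
        exact DFunLike.congr_fun (F := StdDual k U) hgh u
      · intro g
        refine ⟨LinearMap.comp (show U →ₗ[k] k from g) T''.symm.toLinearMap, ?_⟩
        exact StdDual.ext fun u => congrArg g (T''.symm_apply_apply u)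
    exact ⟨(LinearEquiv.ofBijective f hf).toModuleIso⟩

end

end RelationExtension

open RelationExtension in
theorem proposition3p1 {k C : Type u} [Field k] [IsAlgClosed k] [Ring C] [Algebra k C]
    [Module.Finite k C] (hC : RelationExtension.globalDimension C = 2)
    (M : ModuleCat.{u} Cᵐᵒᵖ) [Module.Finite Cᵐᵒᵖ M] :
    Nonempty ((RelationExtension.toRelExt k C).obj (RelationExtension.tau k C M) ≅
        RelationExtension.tau k (RelationExtension.RelExt k C)
          ((RelationExtension.toRelExt k C).obj M)) ↔
      projectiveDimension (RelationExtension.tau k C M) ≤ 1 ∧ injectiveDimension M ≤ 1 := by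
  have := isArtinianRing_op k C
  have := isArtinianRing_op k (RelExt k C)
  let P := (nonempty_minProjPresentation Cᵐᵒᵖ M).some
  let S := (nonempty_minProjPresentation (RelExt k C)ᵐᵒᵖ ((toRelExt k C).obj M)).some
  have := P.finite₀
  have := P.projective₀
  have := ExtDual.finite k C P.P₀
  have hd : Function.Surjective (ExtDual.map k P.d₀) := ExtDual.map_surjective hC P.surjective
  have : Module.Finite Cᵐᵒᵖ (ExtDual k C M) := Module.Finite.of_surjective _ hd
  obtain ⟨Q, _, _, p, _, _, hp, hp'⟩ := exists_projectiveCover Cᵐᵒᵖ (ExtDual k C M)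
  obtain ⟨q, rfl⟩ := Module.projective_lifting_property _ p hd
  obtain ⟨e⟩ := nonempty_transpose_equiv S (inducedPresentation P q hC hp hp')
  let T : transpose S →ₛₗ[relExtFst k C] transpose P :=
    transposeComparison P q hC hp hp' ∘ₛₗ e.toLinearMap
  have hT : Function.Surjective T :=
    (transposeComparison_surjective P q hC hp hp').comp e.surjective
  have hinj : Function.Injective T ↔ Function.Injective (transposeComparison P q hC hp hp') :=
    Function.Injective.of_comp_iff' _ e.bijective
  have : Module.Finite Cᵐᵒᵖ (StdDual k (transpose P)) :=
    Module.Finite.of_restrictScalars_finite k _ _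
  have hτ : projectiveDimension (tau k C M) ≤ 1 ↔ _ :=
    projectiveDimension_le_one_iff k hC (ModuleCat.of Cᵐᵒᵖ (StdDual k (transpose P)))
  rw [hτ, injectiveDimension_le_one_iff k hC M, subsingleton_ext_dual_transpose_iff k hC P,
    and_comm]
  exact (nonempty_iso_stdDual_iff T hT).trans
    (hinj.trans (transposeComparison_injective_iff P q hC hp hp'))
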